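/- Let $s>1/2$ be real. For $N\ge 1$ and $0\le m\le N$ let $$p_m^{(s,N)}(x)=(x-i)^m\,{}_2F_1\!\left(-m,\,s+N-m;\,2s+2N-2m;\,\tfrac{2}{1+ix}\right)$$ be the monic pseudo-Jacobi polynomials, and let $$\boldsymbol\rho_N^{(s)}(x)=\gamma_{N-1,s}^2\,(1+x^2)^{-N-s}\left[p_{N-1}^{(s,N)}\big(p_N^{(s,N)}\big)'-p_N^{(s,N)}\big(p_{N-1}^{(s,N)}\big)'\right](x),\qquad \gamma_{N-1,s}^2=\frac{2^{2s}}{\pi}\,\frac{\Gamma(2s+N+1)\Gamma(s+1)^2}{\Gamma(N)\Gamma(2s+1)\Gamma(2s+2)},$$ be the one-point eigenvalue density of the $N\times N$ generalized Cauchy ensemble, i.e. of the probability measure on Hermitian matrices with density proportional to $\det(1+\mathbf X^2)^{-s-N}$. Put $\rho_N^{(s)}(x)=N\boldsymbol\rho_N^{(s)}(Nx)$. For every $x>0$ the limit $\rho_\infty^{(s)}(x):=\lim_{N\to\infty}\rho_N^{(s)}(x)$ exists and equals $$\rho_\infty^{(s)}(x)=\frac1{2\pi}\,\frac{\Gamma(s+1)^2}{\Gamma(2s+1)\Gamma(2s+2)}\;W\big[Q^{(s)},P^{(s)}\big](x),$$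 where $W[f,g]=fg'-f'g$ and, with $J_\nu$ the Bessel function of the first kind of order $\nu$, $$P^{(s)}(x)=2^{2s-1/2}\,\Gamma(s+\tfrac12)\,x^{-1/2}J_{s-1/2}(1/x),\qquad Q^{(s)}(x)=2^{2s+3/2}\,\Gamma(s+\tfrac32)\,x^{-1/2}J_{s+1/2}(1/x).$$ Moreover, for every real $y$ with $1<y<2s+1$, the function $x\mapsto x^y\rho_\infty^{(s)}(x)$ is integrable on $(0,\infty)$ and $$\int_0^\infty x^y\,\rho_\infty^{(s)}(x)\,dx=\frac{s\,\Gamma\!\left(\frac{y-1}{2}\right)\Gamma\!\left(\frac{1-y}{2}+s\right)}{4\sqrt\pi\;\Gamma\!\left(\frac y2+1\right)\Gamma\!\left(\frac{1+y}{2}+s\right)}.$$ -/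

import Mathlib

namespace CauchyEnsemble

noncomputable section

/-- The weight `(1 + x ^ 2) ^ (-N - s)` of the pseudo-Jacobi ensemble, for a real parameter `s`. -/
def weight (s : ℝ) (N : ℕ) (x : ℝ) : ℝ :=
  (1 + x ^ 2) ^ (-(N : ℝ) - s)

/-- The monic pseudo-Jacobi polynomial `p_m^{(s,N)}`, as a function on the real line:
`(x - i) ^ m * ₂F₁(-m, s + N - m; 2 s + 2 N - 2 m; 2 / (1 + i x))`.
For real `s` its values are real, although the individual factors are not. -/
def pseudoJacobi (s : ℝ) (N m : ℕ) (x : ℝ) : ℂ :=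
  ((x : ℂ) - Complex.I) ^ m *
    ordinaryHypergeometric (-(m : ℂ)) ((s : ℂ) + N - m) (2 * (s : ℂ) + 2 * N - 2 * m)
      (2 / (1 + Complex.I * (x : ℂ)))

/-- The inverse of the squared norm of the polynomial of degree `N - 1` in `L²` of the weight. -/
def gammaSq (s : ℝ) (N : ℕ) : ℝ :=
  2 ^ (2 * s) / Real.pi *
    ((Real.Gamma (2 * s + N + 1) * Real.Gamma (s + 1) * Real.Gamma (s + 1)) /
      (Real.Gamma N * Real.Gamma (2 * s + 1) * Real.Gamma (2 * s + 2)))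

/-- The one-point density of the eigenvalues of the `N × N` generalized Cauchy ensemble, `1 ≤ N`,
in its Christoffel-Darboux form. (Its values are real, like those of the polynomials.) -/
def onePointDensity (s : ℝ) (N : ℕ) (x : ℝ) : ℂ :=
  (pseudoJacobi s N (N - 1) x * deriv (pseudoJacobi s N N) x
      - pseudoJacobi s N N x * deriv (pseudoJacobi s N (N - 1)) x)
    * (weight s N x : ℂ) * (gammaSq s N : ℂ)

/-- The density `ρ_N(x) = N * 𝛒_N(N x)` of the eigenvalues divided by `N`. -/
def scaledDensity (s : ℝ) (N : ℕ) (x : ℝ) : ℂ :=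
  (N : ℂ) * onePointDensity s N (N * x)

/-- The Bessel function of the first kind of real order `ν`, on the positive half-line. -/
def besselJ (ν x : ℝ) : ℝ :=
  ∑' k : ℕ, (-1) ^ k / ((k.factorial : ℝ) * Real.Gamma ((k : ℝ) + ν + 1))
    * (x / 2) ^ (2 * (k : ℝ) + ν)

/-- `P(x) = 2 ^ (2 s - 1/2) Γ(s + 1/2) x ^ (-1/2) J_{s - 1/2}(1 / x)`. -/
def limitP (s x : ℝ) : ℝ :=
  2 ^ (2 * s - 1 / 2) * Real.Gamma (s + 1 / 2) * x ^ (-(1 / 2 : ℝ)) * besselJ (s - 1 / 2) (1 / x)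

/-- `Q(x) = 2 ^ (2 s + 3/2) Γ(s + 3/2) x ^ (-1/2) J_{s + 1/2}(1 / x)`. -/
def limitQ (s x : ℝ) : ℝ :=
  2 ^ (2 * s + 3 / 2) * Real.Gamma (s + 3 / 2) * x ^ (-(1 / 2 : ℝ)) * besselJ (s + 1 / 2) (1 / x)

/-- The Wronskian `W[f, g] = f g' - f' g`. -/
def wronskian (f g : ℝ → ℝ) (x : ℝ) : ℝ :=
  f x * deriv g x - deriv f x * g x

/-- The limiting density `ρ_∞`, for `x > 0`, as a Wronskian of Bessel-type functions. -/
def limitDensity (s x : ℝ) : ℝ :=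
  1 / (2 * Real.pi) *
    ((Real.Gamma (s + 1) * Real.Gamma (s + 1)) /
      (Real.Gamma (2 * s + 1) * Real.Gamma (2 * s + 2))) *
    wronskian (limitQ s) (limitP s) x

end

end CauchyEnsemble

/-! Pointwise limit. With u = 2/(1+ix), the polynomial of degree m is (x-i)^m times a terminating
series S_m(u). Since (x-i) du/dx = -u, the Christoffel-Darboux bracket becomes (x-i)^(2(N-1)) times
an expression in S_N, S_(N-1) and their images under u d/du. The terms of order N cancel there,
because the degrees differ by one (`pseudoJacobi_wronskian`). At the point Nx one has N u → -2i/x,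
so the terminating series converge to ₁F₁(a; 2a; 2iz) with z = 1/x and a = s or s+1. Kummer's second
formula (`kummer_eq_exp_mul_normBessel`) writes these as e^(iz)F(z) and e^(iz)G(z), where F and G
are the Bessel functions of orders s-1/2 and s+1/2 normalized to 1 at the origin. The phase e^(2iz)
is cancelled by the limit of (1-iz/N)^(2(N-1)), and the powers of N by a Gamma ratio. What remains
is `besselKernel`, a quadratic form B in F and G, which is also what the Wronskian of Q and P equals
up to an elementary factor (`wronskian_limitQ_limitP`).

Moments. After x = 1/z one needs ∫ z^(2s-y) B(z) dz. The equation zB' = 2s(FG - B) yields z^(2s)B =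
O(1) by an energy estimate, hence integrability, and integration by parts replaces B by 2s/(y-1)
times FG. The product FG is a ₁F₂ in -z² (Vandermonde and duplication), which is a Beta average of a
single ₀F₁. A Mellin transform factors over such averages, so the integral is a Beta integral times
the Mellin transform of ₀F₁. The latter comes from the same principle, as a Gamma average of ₀F₁ is
an exponential. -/

namespace CauchyEnsemble

noncomputable section

open Filter Topology MeasureTheory

/-! ### Power series with coefficients bounded by R^k/k!. -/

section EntireSeries

variable {𝕜 : Type*} [RCLike 𝕜]

/-- The sum of the power series with coefficients `c`. -/
def powerSum (c : ℕ → 𝕜) (w : 𝕜) : 𝕜 := ∑' k, c k * w ^ k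

theorem norm_powerSum_term_le {c : ℕ → 𝕜} {R r : ℝ} {w : 𝕜} (hR : 0 ≤ R)
    (hc : ∀ k, ‖c k‖ ≤ R ^ k / k.factorial) (hw : ‖w‖ ≤ r) (k : ℕ) :
    ‖c k * w ^ k‖ ≤ (R * r) ^ k / k.factorial := by
  rw [norm_mul, norm_pow, mul_pow, mul_div_right_comm]
  gcongr
  exact hc k

theorem summable_norm_powerSum {c : ℕ → 𝕜} {R : ℝ} (hR : 0 ≤ R)
    (hc : ∀ k, ‖c k‖ ≤ R ^ k / k.factorial) (w : 𝕜) :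
    Summable fun k => ‖c k * w ^ k‖ :=
  Summable.of_nonneg_of_le (fun _ => norm_nonneg _)
    (norm_powerSum_term_le hR hc le_rfl) (Real.summable_pow_div_factorial _)

theorem summable_powerSum {c : ℕ → 𝕜} {R : ℝ} (hR : 0 ≤ R)
    (hc : ∀ k, ‖c k‖ ≤ R ^ k / k.factorial) (w : 𝕜) :
    Summable fun k => c k * w ^ k :=
  (summable_norm_powerSum hR hc w).of_norm

/-- From k ≤ 2^k: the class of coefficient bounds R^k/k! is stable under the Euler operator, at the
price of doubling R. -/
theorem norm_natCast_mul_coeff_le {c : ℕ → 𝕜} {R : ℝ} (hR : 0 ≤ R)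
    (hc : ∀ k, ‖c k‖ ≤ R ^ k / k.factorial) (k : ℕ) :
    ‖(k : 𝕜) * c k‖ ≤ (2 * R) ^ k / k.factorial := by
  rw [norm_mul, mul_pow, mul_div_assoc, RCLike.norm_natCast]
  gcongr
  · exact_mod_cast Nat.lt_two_pow_self.le
  · exact hc k

/-- The condition 1 ≤ r allows the truncated exponent k - 1 to be raised to k uniformly, k = 0
included. -/
theorem norm_deriv_powerSum_term_le {c : ℕ → 𝕜} {R r : ℝ} {y : 𝕜} (hR : 0 ≤ R)
    (hc : ∀ k, ‖c k‖ ≤ R ^ k / k.factorial) (hr : 1 ≤ r) (hy : ‖y‖ ≤ r) (k : ℕ) :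
    ‖c k * (k * y ^ (k - 1))‖ ≤ (2 * R * r) ^ k / k.factorial := by
  have h1 := norm_natCast_mul_coeff_le hR hc k
  calc ‖c k * (k * y ^ (k - 1))‖ = ‖(k : 𝕜) * c k‖ * ‖y‖ ^ (k - 1) := by
        simp only [norm_mul, norm_pow]; ring
    _ ≤ (2 * R) ^ k / k.factorial * r ^ k := by
        gcongr
        calc ‖y‖ ^ (k - 1) ≤ r ^ (k - 1) := by gcongr
          _ ≤ r ^ k := pow_le_pow_right₀ hr (Nat.sub_le _ _)
    _ = _ := by rw [mul_pow (2 * R)]; ring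

/-- Termwise differentiation of an entire power series. -/
theorem hasDerivAt_powerSum {c : ℕ → 𝕜} {R : ℝ} (hR : 0 ≤ R)
    (hc : ∀ k, ‖c k‖ ≤ R ^ k / k.factorial) (w : 𝕜) :
    HasDerivAt (powerSum c) (powerSum (fun k => ((k : 𝕜) + 1) * c (k + 1)) w) w := by
  set r := ‖w‖ + 1 with hr
  have hr1 : 1 ≤ r := by simp [hr]
  have h : HasDerivAt (powerSum c) (∑' k : ℕ, c k * (k * w ^ (k - 1))) w := by
    refine hasDerivAt_tsum_of_isPreconnected
      (g := fun k y => c k * y ^ k) (g' := fun k y => c k * (k * y ^ (k - 1)))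
      (u := fun k => (2 * R * r) ^ k / k.factorial)
      (Real.summable_pow_div_factorial _) (t := Metric.ball 0 r) Metric.isOpen_ball
      (convex_ball _ _).isPreconnected ?_ ?_ (y₀ := w) ?_ (summable_powerSum hR hc w) ?_
    · intro n y _
      exact (hasDerivAt_pow n y).const_mul _
    · intro n y hy
      exact norm_deriv_powerSum_term_le hR hc hr1 (by simpa using (mem_ball_zero_iff.1 hy).le) n
    · simp [hr]
    · simp [hr]
  have hs : Summable fun k : ℕ => c k * (k * w ^ (k - 1)) :=
    Summable.of_norm_bounded (Real.summable_pow_div_factorial (2 * R * r))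
      (norm_deriv_powerSum_term_le hR hc hr1 (by simp [hr]))
  convert h using 1
  rw [hs.tsum_eq_zero_add]
  simp only [powerSum, Nat.cast_zero, zero_mul, mul_zero, zero_add, Nat.add_sub_cancel]
  exact tsum_congr fun k => by push_cast; ring

/-- The Euler operator `w d/dw` multiplies the `k`-th coefficient by `k`. -/
theorem mul_powerSum_shifted {c : ℕ → 𝕜} {R : ℝ} (hR : 0 ≤ R)
    (hc : ∀ k, ‖c k‖ ≤ R ^ k / k.factorial) (w : 𝕜) :
    w * powerSum (fun k => ((k : 𝕜) + 1) * c (k + 1)) w = powerSum (fun k => (k : 𝕜) * c k) w := by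
  have hs := summable_powerSum (by positivity) (norm_natCast_mul_coeff_le hR hc) w
  rw [powerSum, powerSum, hs.tsum_eq_zero_add, ← tsum_mul_left]
  simp only [Nat.cast_zero, zero_mul, zero_add]
  exact tsum_congr fun k => by push_cast; ring

theorem continuous_powerSum {c : ℕ → 𝕜} {R : ℝ} (hR : 0 ≤ R)
    (hc : ∀ k, ‖c k‖ ≤ R ^ k / k.factorial) : Continuous (powerSum c) :=
  continuous_iff_continuousAt.2 fun w => (hasDerivAt_powerSum hR hc w).continuousAt

theorem powerSum_zero_right (c : ℕ → 𝕜) : powerSum c 0 = c 0 := by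
  rw [powerSum, tsum_eq_single 0]
  · simp
  · intro k hk; simp [hk]

theorem powerSum_const_mul (a : 𝕜) (c : ℕ → 𝕜) (w : 𝕜) :
    powerSum (fun k => a * c k) w = a * powerSum c w := by
  rw [powerSum, powerSum, ← tsum_mul_left]
  exact tsum_congr fun k => by ring

end EntireSeries

/-! ### Rising factorials: duplication and Vandermonde convolution. -/

section Pochhammer

/-- The rising factorial `b (b + 1) ⋯ (b + k - 1)`. -/
def rising (b : ℝ) (k : ℕ) : ℝ := (ascPochhammer ℝ k).eval b

@[simp] theorem rising_zero (b : ℝ) : rising b 0 = 1 := by simp [rising]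

theorem rising_succ (b : ℝ) (k : ℕ) : rising b (k + 1) = rising b k * (b + k) :=
  ascPochhammer_succ_eval k b

theorem rising_succ_left (b : ℝ) (k : ℕ) : rising b (k + 1) = b * rising (b + 1) k := by
  simp [rising, ascPochhammer_succ_left, Polynomial.eval_comp]

theorem mul_rising_add_one (b : ℝ) (k : ℕ) : b * rising (b + 1) k = rising b k * (b + k) := by
  rw [← rising_succ_left, rising_succ]

theorem rising_add (b : ℝ) (j k : ℕ) : rising b (j + k) = rising b j * rising (b + j) k := by
  induction k with
  | zero => simp
  | succ k ih => rw [← add_assoc, rising_succ, rising_succ, ih]; push_cast; ring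

theorem rising_pos {b : ℝ} (hb : 0 < b) (k : ℕ) : 0 < rising b k := ascPochhammer_pos k b hb

theorem rising_mono {a b : ℝ} (ha : 0 < a) (hab : a ≤ b) (k : ℕ) : rising a k ≤ rising b k := by
  induction k with
  | zero => simp
  | succ k ih =>
    rw [rising_succ, rising_succ]
    have := rising_pos (ha.trans_le hab) k
    gcongr

theorem one_le_rising {b : ℝ} (hb : 1 ≤ b) (k : ℕ) : 1 ≤ rising b k := by
  induction k with
  | zero => simp
  | succ k ih =>
    rw [rising_succ]
    exact one_le_mul_of_one_le_of_one_le ih (by linarith [k.cast_nonneg (α := ℝ)])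

theorem Gamma_add_natCast {b : ℝ} (hb : 0 < b) (k : ℕ) :
    Real.Gamma (b + k) = Real.Gamma b * rising b k := by
  induction k with
  | zero => simp
  | succ k ih =>
    rw [rising_succ, Nat.cast_succ, ← add_assoc, Real.Gamma_add_one (by positivity), ih]; ring

theorem rising_two_mul (b : ℝ) (k : ℕ) :
    rising (2 * b) (2 * k) = 4 ^ k * (rising b k * rising (b + 1 / 2) k) := by
  induction k with
  | zero => simp
  | succ k ih =>
    rw [Nat.mul_succ, rising_succ, rising_succ, ih, rising_succ, rising_succ]; push_cast; ring

theorem ascPochhammer_eval_ofReal (b : ℝ) (k : ℕ) :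
    (ascPochhammer ℂ k).eval (b : ℂ) = (rising b k : ℂ) := by
  induction k with
  | zero => simp
  | succ k ih => rw [ascPochhammer_succ_eval, ih, rising_succ]; push_cast; ring

/-- Vandermonde's convolution in terms of rising factorials. -/
theorem sum_antidiagonal_rising {b b' : ℝ} (hb : 0 < b) (hb' : 0 < b') (n : ℕ) :
    ∑ p ∈ Finset.HasAntidiagonal.antidiagonal n, 1 / (p.1.factorial * rising b p.1) *
        (1 / (p.2.factorial * rising b' p.2)) =
      rising (b + b' + n - 1) n / (n.factorial * rising b n * rising b' n) := by
  have key (r : ℝ) (k : ℕ) : Ring.choose r k = rising (r - k + 1) k / k.factorial := by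
    rw [Ring.choose_eq_smul, Polynomial.descPochhammer_smeval_eq_ascPochhammer,
      Polynomial.ascPochhammer_smeval_eq_eval, rising]
    simp [div_eq_inv_mul]
  -- These upper entries are chosen so that choose(b'+n-1, p.1) is rising(b'+p.2, p.1)/p.1!, a tail
  -- of `rising b' n`; dividing by `rising b' n` leaves the reciprocal of `rising b' p.2`.
  have h := Ring.add_choose_eq n (Commute.all (b' + n - 1) (b + n - 1))
  rw [key] at h
  have h2 : rising (b + b' + n - 1) n / (n.factorial : ℝ) =
      ∑ p ∈ Finset.HasAntidiagonal.antidiagonal n,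
        Ring.choose (b' + n - 1) p.1 * Ring.choose (b + n - 1) p.2 := by
    rw [← h]; congr 2; ring
  rw [mul_assoc, ← div_div, h2, Finset.sum_div]
  refine Finset.sum_congr rfl fun p hp => ?_
  have hp : p.1 + p.2 = n := Finset.HasAntidiagonal.mem_antidiagonal.1 hp
  have hn : (n : ℝ) = p.1 + p.2 := by exact_mod_cast hp.symm
  have e1 : rising b' n = rising b' p.2 * rising (b' + p.2) p.1 := by
    rw [← rising_add, add_comm, hp]
  have e2 : rising b n = rising b p.1 * rising (b + p.1) p.2 := by rw [← rising_add, hp]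
  rw [key, key, e1, e2, show b' + n - 1 - p.1 + 1 = b' + p.2 by rw [hn]; ring,
    show b + n - 1 - p.2 + 1 = b + p.1 by rw [hn]; ring]
  have := (rising_pos hb p.1).ne'
  have := (rising_pos hb' p.2).ne'
  have := (rising_pos (show 0 < b' + p.2 by positivity) p.1).ne'
  have := (rising_pos (show 0 < b + p.1 by positivity) p.2).ne'
  field_simp

end Pochhammer

/-! ### The series ₀F₁ and normalized Bessel functions. -/

section BesselSeries

/-- The confluent hypergeometric limit function `₀F₁(; b; w)`. -/
def hyp01 (b w : ℝ) : ℝ := powerSum (fun k => 1 / (k.factorial * rising b k)) w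

theorem norm_hyp01_coeff_le {b : ℝ} (hb : 1 ≤ b) (k : ℕ) :
    ‖1 / (k.factorial * rising b k)‖ ≤ 1 ^ k / k.factorial := by
  have h := one_le_rising hb k
  rw [Real.norm_of_nonneg (by positivity), one_pow, ← div_div]
  exact div_le_self (by positivity) h

theorem hasDerivAt_hyp01 {b : ℝ} (hb : 1 ≤ b) (w : ℝ) :
    HasDerivAt (hyp01 b) (hyp01 (b + 1) w / b) w := by
  refine (hasDerivAt_powerSum zero_le_one (norm_hyp01_coeff_le hb) w).congr_deriv
        (Eq.symm ?_)
  rw [hyp01, div_eq_inv_mul, ← powerSum_const_mul]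
  congr 1 with k
  have := (rising_pos (show 0 < b + 1 by linarith) k).ne'
  have : b ≠ 0 := by linarith
  rw [rising_succ_left, Nat.factorial_succ]
  push_cast
  field_simp

theorem continuous_hyp01 {b : ℝ} (hb : 1 ≤ b) : Continuous (hyp01 b) :=
  continuous_powerSum zero_le_one (norm_hyp01_coeff_le hb)

theorem hyp01_zero_right (b : ℝ) : hyp01 b 0 = 1 := by simp [hyp01, powerSum_zero_right]

/-- The left side is w d/dw of `hyp01 (b + 1)`, so this is an identity between coefficients. It
eliminates the parameter b + 2 from derivatives. -/
theorem mul_hyp01_add_two {b : ℝ} (hb : 1 ≤ b) (w : ℝ) :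
    w * (hyp01 (b + 2) w / (b + 1)) = b * (hyp01 b w - hyp01 (b + 1) w) := by
  have hb1 : 1 ≤ b + 1 := by linarith
  have h1 := (hasDerivAt_hyp01 hb1 w).unique
    (hasDerivAt_powerSum zero_le_one (norm_hyp01_coeff_le hb1) w)
  rw [show b + 2 = b + 1 + 1 by ring, h1,
    mul_powerSum_shifted zero_le_one (norm_hyp01_coeff_le hb1), hyp01, hyp01, mul_sub, powerSum,
    powerSum, powerSum, ← tsum_mul_left, ← tsum_mul_left, ← Summable.tsum_sub]
  · refine tsum_congr fun k => ?_
    have h2 := mul_rising_add_one b k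
    have h3 := (rising_pos (show 0 < b by linarith) k).ne'
    have h4 := (rising_pos (show 0 < b + 1 by linarith) k).ne'
    have : b ≠ 0 := by linarith
    have h5 : rising (b + 1) k = rising b k * (b + k) / b := by rw [← h2]; field_simp
    have : b + k ≠ 0 := by positivity
    rw [h5]
    field_simp
    ring
  · exact (summable_powerSum zero_le_one (norm_hyp01_coeff_le hb) w).mul_left _
  · exact (summable_powerSum zero_le_one (norm_hyp01_coeff_le hb1) w).mul_left _

/-- The Bessel function of order `b - 1`, divided by its leading term at the origin. -/
def normBessel (b z : ℝ) : ℝ := hyp01 b (-(z ^ 2 / 4))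

theorem normBessel_zero_right (b : ℝ) : normBessel b 0 = 1 := by
  simp [normBessel, hyp01_zero_right]

theorem hasDerivAt_normBessel {b : ℝ} (hb : 1 ≤ b) (z : ℝ) :
    HasDerivAt (normBessel b) (-(z * normBessel (b + 1) z / (2 * b))) z := by
  have h : HasDerivAt (fun z : ℝ => -(z ^ 2 / 4)) (-(z / 2)) z := by
    refine (((hasDerivAt_pow 2 z).div_const 4).neg).congr_deriv
        (Eq.symm ?_)
    push_cast; ring
  refine ((hasDerivAt_hyp01 hb _).comp z h).congr_deriv
        (Eq.symm ?_)
  rw [normBessel]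
  have : b ≠ 0 := by linarith
  field_simp

theorem continuous_normBessel {b : ℝ} (hb : 1 ≤ b) : Continuous (normBessel b) :=
  continuous_iff_continuousAt.2 fun z => (hasDerivAt_normBessel hb z).continuousAt

/-- Multiplying by z removes the singularity of the Bessel system at 0, so the formula holds at the
origin, where the uniqueness argument for Kummer's formula starts. -/
theorem hasDerivAt_mul_normBessel {b : ℝ} (hb : 1 ≤ b) (z : ℝ) :
    HasDerivAt (fun z => z * normBessel (b + 1) z)
      (normBessel (b + 1) z + 2 * b * (normBessel b z - normBessel (b + 1) z)) z := by
  refine ((hasDerivAt_id z).mul (hasDerivAt_normBessel (show 1 ≤ b + 1 by linarith) z)).congr_deriv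
        (Eq.symm ?_)
  have h := mul_hyp01_add_two hb (-(z ^ 2 / 4))
  have : b + 1 ≠ 0 := by linarith
  simp only [normBessel, id, show b + 1 + 1 = b + 2 by ring]
  field_simp at h ⊢
  linarith

/-- With `hasDerivAt_normBessel`, this closes the parameters b and b + 1 into a first order system.
-/
theorem hasDerivAt_normBessel_add_one {b : ℝ} (hb : 1 ≤ b) {z : ℝ} (hz : z ≠ 0) :
    HasDerivAt (normBessel (b + 1)) (2 * b * (normBessel b z - normBessel (b + 1) z) / z) z := by
  have h1 := hasDerivAt_normBessel (show 1 ≤ b + 1 by linarith) z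
  have h2 := ((hasDerivAt_id z).mul h1).unique (hasDerivAt_mul_normBessel hb z)
  refine (h1).congr_deriv
        (Eq.symm ?_)
  simp only [id] at h2
  rw [div_eq_iff hz]
  linarith

end BesselSeries

/-! ### Kummer's second formula. -/

section Kummer

/-- The confluent hypergeometric function `₁F₁(s; 2 s; w)`. -/
def kummer (s : ℝ) (w : ℂ) : ℂ :=
  powerSum (fun k => ((rising s k / (rising (2 * s) k * k.factorial) : ℝ) : ℂ)) w

theorem norm_rising_div_le {a b : ℝ} (ha : 0 < a) (hab : a ≤ b) (k : ℕ) :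
    ‖((rising a k / (rising b k * k.factorial) : ℝ) : ℂ)‖ ≤ 1 ^ k / k.factorial := by
  have h1 := rising_pos ha k
  have h2 := rising_pos (ha.trans_le hab) k
  rw [Complex.norm_real, Real.norm_of_nonneg (by positivity), one_pow, ← div_div]
  gcongr
  exact (div_le_one h2).2 (rising_mono ha hab k)

/-- The function `₁F₁(s + 1; 2 s + 1; w)`. -/
def kummerMid (s : ℝ) (w : ℂ) : ℂ :=
  powerSum (fun k => ((rising (s + 1) k / (rising (2 * s + 1) k * k.factorial) : ℝ) : ℂ)) w

theorem hasDerivAt_kummer {s : ℝ} (hs : 0 < s) (w : ℂ) :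
    HasDerivAt (kummer s) (kummerMid s w / 2) w := by
  refine (hasDerivAt_powerSum zero_le_one (norm_rising_div_le hs (by linarith : s ≤ 2 * s)) w).congr_deriv
        (Eq.symm ?_)
  rw [kummerMid, div_eq_inv_mul, ← powerSum_const_mul]
  congr 1 with k
  have := (rising_pos (show 0 < 2 * s + 1 by linarith) k).ne'
  rw [rising_succ_left, rising_succ_left, Nat.factorial_succ]
  norm_cast
  have h2 : (2 : ℂ)⁻¹ = ((2⁻¹ : ℝ) : ℂ) := by norm_num
  rw [h2]
  norm_cast
  push_cast
  field_simp

/-- A contiguous relation, checked on coefficients. Together with `mul_deriv_kummer` it eliminates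
`kummerMid`, so that `kummer s` and `kummer (s + 1)` satisfy a closed system. -/
theorem kummerMid_sub_kummer {s : ℝ} (hs : 0 < s) (w : ℂ) :
    kummerMid s w - kummer s w = w / (2 * (2 * s + 1)) * kummer (s + 1) w := by
  have e1 := norm_rising_div_le hs (by linarith : s ≤ 2 * s)
  have e2 := norm_rising_div_le (show 0 < s + 1 by linarith) (by linarith : s + 1 ≤ 2 * s + 1)
  have s1 := summable_powerSum zero_le_one e1 w
  have s2 := summable_powerSum zero_le_one e2 w
  rw [kummerMid, kummer, kummer, powerSum, powerSum, powerSum, ← s2.tsum_sub s1,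
    (s2.sub s1).tsum_eq_zero_add, ← tsum_mul_left]
  simp only [rising_zero, pow_zero, sub_self, zero_add]
  refine tsum_congr fun k => ?_
  have h2 := mul_rising_add_one (2 * s + 1) k
  have h3 := (rising_pos (show 0 < 2 * s + 1 + 1 by linarith) k).ne'
  have : 2 * s + 1 + k ≠ 0 := by positivity
  have : 2 * s + 1 ≠ 0 := by positivity
  have h5 : rising (2 * s + 1) k = (2 * s + 1) * rising (2 * s + 1 + 1) k / (2 * s + 1 + k) := by
    rw [h2]; field_simp
  have h6 : rising (s + 1) (k + 1) / (rising (2 * s + 1) (k + 1) * (k + 1).factorial) -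
      rising s (k + 1) / (rising (2 * s) (k + 1) * (k + 1).factorial) =
      1 / (2 * (2 * s + 1)) * (rising (s + 1) k / (rising (2 * (s + 1)) k * k.factorial)) := by
    rw [rising_succ (s + 1), rising_succ_left s, rising_succ_left (2 * s),
      rising_succ_left (2 * s + 1), h5, Nat.factorial_succ,
      show 2 * (s + 1) = 2 * s + 1 + 1 by ring]
    push_cast
    field_simp
    ring
  rw [← sub_mul, ← Complex.ofReal_sub, h6]
  push_cast
  ring

theorem mul_deriv_kummer {s : ℝ} (hs : 0 < s) (w : ℂ) :
    w * (kummerMid (s + 1) w / 2) = (2 * s + 1) * (kummerMid s w - kummer (s + 1) w) := by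
  have e1 := norm_rising_div_le (show 0 < s + 1 by linarith) (by linarith : s + 1 ≤ 2 * (s + 1))
  have e2 := norm_rising_div_le (show 0 < s + 1 by linarith) (by linarith : s + 1 ≤ 2 * s + 1)
  have h1 := (hasDerivAt_kummer (show 0 < s + 1 by linarith) w).unique
    (hasDerivAt_powerSum zero_le_one e1 w)
  rw [h1, mul_powerSum_shifted zero_le_one e1, kummer, kummerMid, powerSum, powerSum, powerSum,
    ← Summable.tsum_sub (summable_powerSum zero_le_one e2 w) (summable_powerSum zero_le_one e1 w),
    ← tsum_mul_left]
  refine tsum_congr fun k => ?_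
  rw [← sub_mul, ← mul_assoc]
  congr 1
  norm_cast
  have h2 := mul_rising_add_one (2 * s + 1) k
  have h3 := (rising_pos (show 0 < 2 * s + 1 by linarith) k).ne'
  have : 2 * s + 1 + k ≠ 0 := by positivity
  have : 2 * s + 1 ≠ 0 := by positivity
  have h5 : rising (2 * (s + 1)) k = rising (2 * s + 1) k * (2 * s + 1 + k) / (2 * s + 1) := by
    rw [← h2, show 2 * (s + 1) = 2 * s + 1 + 1 by ring]; field_simp
  rw [h5]
  field_simp
  ring

/-- Both sides of Kummer's second formula solve the same first order system; the energy of the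
difference is nonincreasing and vanishes at the origin. -/
theorem kummer_eq_exp_mul_normBessel {s : ℝ} (hs : 1 / 2 < s) {z : ℝ} (hz : 0 < z) :
    kummer s (2 * Complex.I * z) = Complex.exp (Complex.I * z) * normBessel (s + 1 / 2) z ∧
    kummer (s + 1) (2 * Complex.I * z) =
      Complex.exp (Complex.I * z) * normBessel (s + 1 / 2 + 1) z := by
  have hs0 : 0 < s := by linarith
  set b := s + 1 / 2 with hb
  have hb1 : 1 ≤ b := by linarith
  have hc0 : (2 * (s : ℂ) + 1) ≠ 0 := by norm_cast; positivity
  have hlin (t : ℂ) : HasDerivAt (fun t : ℂ => 2 * Complex.I * t) (2 * Complex.I) t := by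
    simpa using (hasDerivAt_id t).const_mul (2 * Complex.I)
  have hexp (t : ℂ) : HasDerivAt (fun t : ℂ => Complex.exp (-Complex.I * t))
      (Complex.exp (-Complex.I * t) * (-Complex.I)) t := by
    have := ((hasDerivAt_id t).const_mul (-Complex.I)).cexp
    simpa using this
  set f : ℂ → ℂ := fun t => Complex.exp (-Complex.I * t) * kummer s (2 * Complex.I * t) with hf
  set g : ℂ → ℂ := fun t => Complex.exp (-Complex.I * t) * kummer (s + 1) (2 * Complex.I * t) with hg
  have hfd (t : ℂ) : HasDerivAt f (-(t * g t / (2 * s + 1))) t := by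
    refine ((hexp t).mul ((hasDerivAt_kummer hs0 _).comp t (hlin t))).congr_deriv
        (Eq.symm ?_)
    have h := kummerMid_sub_kummer hs0 (2 * Complex.I * t)
    rw [sub_eq_iff_eq_add, mul_assoc 2, mul_div_mul_left _ _ two_ne_zero] at h
    rw [← mul_assoc] at h
    simp only [hg, Function.comp]
    rw [h]
    linear_combination (-(t * (Complex.exp (-Complex.I * t) * kummer (s + 1) (2 * Complex.I * t)) /
      (2 * s + 1))) * Complex.I_sq
  have hgd (t : ℂ) : HasDerivAt (fun t => t * g t) (g t + (2 * s + 1) * (f t - g t)) t := by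
    refine ((hasDerivAt_id t).mul
      ((hexp t).mul ((hasDerivAt_kummer (by linarith : 0 < s + 1) _).comp t (hlin t)))).congr_deriv
        (Eq.symm ?_)
    have h1 := kummerMid_sub_kummer hs0 (2 * Complex.I * t)
    have h2 := mul_deriv_kummer hs0 (2 * Complex.I * t)
    rw [sub_eq_iff_eq_add] at h1
    rw [h1] at h2
    have h3 : (2 * (s : ℂ) + 1) * (2 * Complex.I * t / (2 * (2 * s + 1)) *
      kummer (s + 1) (2 * Complex.I * t)) = Complex.I * t * kummer (s + 1) (2 * Complex.I * t) := by
      field_simp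
    simp only [hf, hg, id, Pi.mul_apply, Function.comp]
    linear_combination (-Complex.exp (-Complex.I * t)) * h2 - Complex.exp (-Complex.I * t) * h3
  -- D and D2 are the errors in the two formulas, and V is D2 multiplied by t/(2s+1). The pair (D,
  -- V) solves a system regular at 0 and vanishes there.
  set D : ℝ → ℂ := fun t => f t - normBessel b t with hD
  set V : ℝ → ℂ := fun t => (t * g t - ((t * normBessel (b + 1) t : ℝ) : ℂ)) / (2 * s + 1) with hV
  set D2 : ℝ → ℂ := fun t => g t - normBessel (b + 1) t with hD2
  have hVD (t : ℝ) : V t = ((t / (2 * s + 1) : ℝ) : ℂ) * D2 t := by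
    simp only [hV, hD2]; push_cast; field_simp
  have hDd (t : ℝ) : HasDerivAt D (-V t) t := by
    refine ((hfd t).comp_ofReal.sub (hasDerivAt_normBessel hb1 t).ofReal_comp).congr_deriv
        (Eq.symm ?_)
    simp only [hV, show 2 * b = 2 * s + 1 by rw [hb]; ring]
    push_cast
    ring
  have hVd (t : ℝ) : HasDerivAt V (D t - ((2 * s / (2 * s + 1) : ℝ) : ℂ) * D2 t) t := by
    refine (((hgd t).comp_ofReal.sub (hasDerivAt_mul_normBessel hb1 t).ofReal_comp).div_const
      (2 * (s : ℂ) + 1)).congr_deriv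
        (Eq.symm ?_)
    simp only [hD, hD2, show 2 * b = 2 * s + 1 by rw [hb]; ring]
    push_cast
    field_simp
    ring
  -- The cross terms ⟨D, V⟩ cancel. Only the damping term in V' survives, and it is nonpositive for
  -- t ≥ 0 because V is a nonnegative multiple of D2.
  have hE (t : ℝ) : HasDerivAt (fun t => ‖D t‖ ^ 2 + ‖V t‖ ^ 2)
      (-(4 * s / (2 * s + 1) ^ 2 * t * ‖D2 t‖ ^ 2)) t := by
    refine ((hDd t).norm_sq.add (hVd t).norm_sq).congr_deriv
        (Eq.symm ?_)
    rw [inner_sub_right, inner_neg_right, real_inner_comm (V t) (D t), hVD]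
    have h (a c : ℝ) (u : ℂ) : inner ℝ ((a : ℂ) * u) ((c : ℂ) * u) = a * c * ‖u‖ ^ 2 := by
      rw [← Complex.real_smul, ← Complex.real_smul, inner_smul_left, inner_smul_right,
        real_inner_self_eq_norm_sq]
      simp
      ring
    rw [h]
    have : 2 * s + 1 ≠ 0 := by positivity
    field_simp
    ring
  have hanti : AntitoneOn (fun t => ‖D t‖ ^ 2 + ‖V t‖ ^ 2) (Set.Ici 0) := by
    refine antitoneOn_of_deriv_nonpos (convex_Ici 0)
      (fun t _ => (hE t).continuousAt.continuousWithinAt)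
      (fun t _ => (hE t).differentiableAt.differentiableWithinAt) fun t ht => ?_
    rw [interior_Ici] at ht
    have : 0 < t := ht
    rw [(hE t).deriv]
    exact neg_nonpos.2 (by positivity)
  have h0 := hanti Set.self_mem_Ici hz.le hz.le
  have hk0 (s : ℝ) : kummer s 0 = 1 := by simp [kummer, powerSum_zero_right]
  have hD0 : D 0 = 0 := by simp [hD, hf, hk0, normBessel_zero_right]
  have hV0 : V 0 = 0 := by simp [hV]
  simp only [hD0, hV0, norm_zero] at h0
  have h1 : D z = 0 := norm_eq_zero.1 (by
    nlinarith [sq_nonneg ‖D z‖, sq_nonneg ‖V z‖, norm_nonneg (D z)])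
  have h2 : V z = 0 := norm_eq_zero.1 (by
    nlinarith [sq_nonneg ‖D z‖, sq_nonneg ‖V z‖, norm_nonneg (V z)])
  have h3 : D2 z = 0 := by
    rw [hVD] at h2
    refine (mul_eq_zero.1 h2).resolve_left ?_
    norm_cast
    positivity
  have hee : Complex.exp (Complex.I * z) * Complex.exp (-Complex.I * z) = 1 := by
    rw [← Complex.exp_add]; simp
  constructor
  · rw [← sub_eq_zero.1 h1, ← mul_assoc, hee, one_mul]
  · rw [← sub_eq_zero.1 h3, ← mul_assoc, hee, one_mul]

end Kummer

/-! ### Terminating hypergeometric series and the Wronskian of the polynomials. -/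

section JacobiSeries

theorem norm_ascPochhammer_neg_natCast_le (m k : ℕ) :
    ‖(ascPochhammer ℂ k).eval (-(m : ℂ))‖ ≤ (m : ℝ) ^ k := by
  induction k with
  | zero => simp
  | succ k ih =>
    rcases le_or_gt k m with h | h
    · rw [ascPochhammer_succ_eval, norm_mul, pow_succ]
      have h1 : -(m : ℂ) + k = ((-((m : ℝ) - k) : ℝ) : ℂ) := by push_cast; ring
      have h2 : (k : ℝ) ≤ m := by exact_mod_cast h
      gcongr
      rw [h1, Complex.norm_real, norm_neg, Real.norm_of_nonneg (by linarith)]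
      linarith [k.cast_nonneg (α := ℝ)]
    · rw [ascPochhammer_eval_neg_coe_nat_of_lt (by omega), norm_zero]
      positivity

theorem norm_ascPochhammer_mul_coeff_le {d : ℕ → ℂ} {R : ℝ}
    (hd : ∀ k, ‖d k‖ ≤ R ^ k / k.factorial) (m k : ℕ) :
    ‖(ascPochhammer ℂ k).eval (-(m : ℂ)) * d k‖ ≤ (m * R) ^ k / k.factorial := by
  rw [norm_mul, mul_pow, mul_div_assoc]
  exact mul_le_mul (norm_ascPochhammer_neg_natCast_le m k) (hd k) (norm_nonneg _) (by positivity)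

/-- Confluence: `₂F₁(-m, …; u)` tends to the confluent series at `-ω` when `m u → ω`. -/
theorem tendsto_powerSum_ascPochhammer {d : ℕ → ℂ} {R : ℝ} (hR : 0 ≤ R)
    (hd : ∀ k, ‖d k‖ ≤ R ^ k / k.factorial) {m : ℕ → ℕ} {u : ℕ → ℂ} {ω : ℂ}
    (hmu : Tendsto (fun n => m n * u n) atTop (𝓝 ω)) (hu : Tendsto u atTop (𝓝 0)) :
    Tendsto (fun n => powerSum (fun k => (ascPochhammer ℂ k).eval (-(m n : ℂ)) * d k) (u n)) atTop
      (𝓝 (powerSum d (-ω))) := by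
  refine tendsto_tsum_of_dominated_convergence
    (bound := fun k => (R * (‖ω‖ + 1)) ^ k / k.factorial) (Real.summable_pow_div_factorial _) ?_ ?_
  · intro k
    have h : Tendsto (fun n => (ascPochhammer ℂ k).eval (-(m n : ℂ)) * u n ^ k) atTop
        (𝓝 ((-ω) ^ k)) := by
      induction k with
      | zero => simp
      | succ k ih =>
        have h1 : Tendsto (fun n => (-(m n : ℂ) + k) * u n) atTop (𝓝 (-ω)) := by
          have := hmu.neg.add (hu.const_mul (k : ℂ))
          simp only [mul_zero, add_zero] at this
          exact this.congr fun n => by ring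
        rw [pow_succ]
        refine (ih.mul h1).congr fun n => ?_
        rw [ascPochhammer_succ_eval, pow_succ]
        ring
    exact (h.const_mul (d k)).congr fun n => by ring
  · have h1 : ∀ᶠ n in atTop, ‖(m n : ℂ) * u n‖ ≤ ‖ω‖ + 1 :=
      hmu.norm.eventually_le_const (by linarith)
    filter_upwards [h1] with n hn k
    rw [norm_mul, Complex.norm_natCast] at hn
    calc ‖(ascPochhammer ℂ k).eval (-(m n : ℂ)) * d k * u n ^ k‖
        ≤ (m n * R) ^ k / k.factorial * ‖u n‖ ^ k := by
          rw [norm_mul, norm_pow]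
          gcongr
          exact norm_ascPochhammer_mul_coeff_le hd _ _
      _ = R ^ k / k.factorial * (m n * ‖u n‖) ^ k := by rw [mul_pow, mul_pow]; ring
      _ ≤ R ^ k / k.factorial * (‖ω‖ + 1) ^ k := by gcongr
      _ = _ := by rw [mul_pow]; ring

/-- The coefficients of `₁F₁(a; 2 a; ·)`. -/
def kummerCoeff (a : ℝ) (k : ℕ) : ℂ := ((rising a k / (rising (2 * a) k * k.factorial) : ℝ) : ℂ)

/-- The terminating series `₂F₁(-m, a; 2 a; u)`. -/
def jacobiSum (a : ℝ) (m : ℕ) (u : ℂ) : ℂ :=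
  powerSum (fun k => (ascPochhammer ℂ k).eval (-(m : ℂ)) * kummerCoeff a k) u

/-- The image of `₂F₁(-m, a; 2 a; u)` under `u d/du`. -/
def jacobiEuler (a : ℝ) (m : ℕ) (u : ℂ) : ℂ :=
  powerSum (fun k => (ascPochhammer ℂ k).eval (-(m : ℂ)) * (k * kummerCoeff a k)) u

theorem norm_kummerCoeff_le {a : ℝ} (ha : 0 < a) (k : ℕ) :
    ‖kummerCoeff a k‖ ≤ 1 ^ k / k.factorial :=
  norm_rising_div_le ha (by linarith) k

/-- The derivative matters only through u D, since (x-i) times the derivative of u = 2/(1+ix) is -u.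
-/
theorem exists_hasDerivAt_jacobiSum {a : ℝ} (ha : 0 < a) (m : ℕ) (u : ℂ) :
    ∃ D, HasDerivAt (jacobiSum a m) D u ∧ u * D = jacobiEuler a m u := by
  have h := norm_ascPochhammer_mul_coeff_le (norm_kummerCoeff_le ha) m
  refine ⟨_, hasDerivAt_powerSum (by positivity) h u, ?_⟩
  rw [mul_powerSum_shifted (by positivity) h, jacobiEuler]
  congr 1 with k
  ring

theorem one_add_I_mul_ne_zero (x : ℝ) : 1 + Complex.I * (x : ℂ) ≠ 0 := fun h => by
  simpa using congrArg Complex.re h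

theorem pseudoJacobi_eq (s : ℝ) (N m : ℕ) (x : ℝ) :
    pseudoJacobi s N m x = ((x : ℂ) - Complex.I) ^ m *
      jacobiSum (s + N - m) m (2 / (1 + Complex.I * x)) := by
  rw [pseudoJacobi, ordinaryHypergeometric_eq_tsum, jacobiSum, powerSum]
  congr 1
  refine tsum_congr fun k => ?_
  rw [show (s : ℂ) + N - m = ((s + N - m : ℝ) : ℂ) by push_cast; ring,
    show 2 * (s : ℂ) + 2 * N - 2 * m = ((2 * (s + N - m) : ℝ) : ℂ) by push_cast; ring,
    ascPochhammer_eval_ofReal, ascPochhammer_eval_ofReal, smul_eq_mul, kummerCoeff]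
  push_cast
  simp only [div_eq_mul_inv, mul_inv]
  ring

theorem hasDerivAt_pseudoJacobi {s : ℝ} {N m : ℕ} (hm : m ≠ 0) (h : 0 < s + N - m) (x : ℝ) :
    HasDerivAt (pseudoJacobi s N m) (((x : ℂ) - Complex.I) ^ (m - 1) *
      (m * jacobiSum (s + N - m) m (2 / (1 + Complex.I * x)) -
        jacobiEuler (s + N - m) m (2 / (1 + Complex.I * x)))) x := by
  obtain ⟨D, hD, hDu⟩ := exists_hasDerivAt_jacobiSum h m (2 / (1 + Complex.I * x))
  have hx := one_add_I_mul_ne_zero x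
  have h1 : HasDerivAt (fun t : ℂ => 2 / (1 + Complex.I * t))
      (-(2 * Complex.I) / (1 + Complex.I * x) ^ 2) (x : ℂ) := by
    have h2 : HasDerivAt (fun t : ℂ => 1 + Complex.I * t) Complex.I (x : ℂ) := by
      simpa using ((hasDerivAt_id (x : ℂ)).const_mul Complex.I).const_add 1
    refine ((hasDerivAt_const (x : ℂ) (2 : ℂ)).div h2 hx).congr_deriv ?_
    simp
  have h3 : HasDerivAt (fun t : ℂ => (t - Complex.I) ^ m) (m * ((x : ℂ) - Complex.I) ^ (m - 1))
      (x : ℂ) := by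
    exact (((hasDerivAt_id (x : ℂ)).sub_const Complex.I).pow m).congr_deriv (by simp)
  have h4 := (h3.mul (hD.comp (x : ℂ) h1)).comp_ofReal
  rw [show pseudoJacobi s N m = fun x : ℝ => ((x : ℂ) - Complex.I) ^ m *
      jacobiSum (s + N - m) m (2 / (1 + Complex.I * x)) from funext (pseudoJacobi_eq s N m)]
  refine h4.congr_deriv ?_
  obtain ⟨n, rfl⟩ := Nat.exists_eq_succ_of_ne_zero hm
  rw [← hDu]
  simp only [Nat.succ_eq_add_one, Nat.add_sub_cancel, Function.comp]
  have h5 : ((x : ℂ) - Complex.I) * Complex.I = 1 + Complex.I * x := by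
    linear_combination -Complex.I_sq
  have h6 : ((x : ℂ) - Complex.I) * (-(2 * Complex.I) / (1 + Complex.I * x) ^ 2) =
      -(2 / (1 + Complex.I * x)) := by
    rw [← h5] at hx ⊢
    field_simp
  rw [pow_succ]
  linear_combination ((x : ℂ) - Complex.I) ^ n * D * h6

/-- The Wronskian of the two consecutive polynomials; the terms of order `N` cancel. -/
theorem pseudoJacobi_wronskian {s : ℝ} (hs : 0 < s) {N : ℕ} (hN : 2 ≤ N) (x : ℝ) :
    pseudoJacobi s N (N - 1) x * deriv (pseudoJacobi s N N) x
      - pseudoJacobi s N N x * deriv (pseudoJacobi s N (N - 1)) x =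
    ((x : ℂ) - Complex.I) ^ (2 * (N - 1)) *
      (jacobiSum (s + 1) (N - 1) (2 / (1 + Complex.I * x)) * jacobiSum s N (2 / (1 + Complex.I * x))
        - jacobiSum (s + 1) (N - 1) (2 / (1 + Complex.I * x)) *
          jacobiEuler s N (2 / (1 + Complex.I * x))
        + jacobiSum s N (2 / (1 + Complex.I * x)) *
          jacobiEuler (s + 1) (N - 1) (2 / (1 + Complex.I * x))) := by
  obtain ⟨n, rfl⟩ := Nat.exists_eq_add_of_le' hN
  have e1 : s + (n + 2 : ℕ) - (n + 2 : ℕ) = s := by ring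
  have e2 : s + (n + 2 : ℕ) - (n + 1 : ℕ) = s + 1 := by push_cast; ring
  have h1 := (hasDerivAt_pseudoJacobi (s := s) (N := n + 2) (m := n + 2) (by omega)
    (by rw [e1]; exact hs) x).deriv
  have h2 := (hasDerivAt_pseudoJacobi (s := s) (N := n + 2) (m := n + 1) (by omega)
    (by rw [e2]; linarith) x).deriv
  rw [e1] at h1
  rw [e2] at h2
  simp only [show n + 2 - 1 = n + 1 by omega, Nat.add_sub_cancel] at h1 h2 ⊢
  rw [h1, h2, pseudoJacobi_eq, pseudoJacobi_eq, e1, e2]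
  push_cast
  ring

end JacobiSeries

/-! ### Large N limit of the density. -/

section Limit

/-- The kernel on the diagonal in terms of the normalized Bessel functions, at `z = 1 / x`. -/
def besselKernel (s z : ℝ) : ℝ :=
  (2 * s + 1) * normBessel (s + 1 / 2) z ^ 2
    - 2 * s * (normBessel (s + 1 / 2) z * normBessel (s + 1 / 2 + 1) z)
    + z ^ 2 * normBessel (s + 1 / 2 + 1) z ^ 2 / (2 * s + 1)

theorem tendsto_jacobiSum {a : ℝ} (ha : 0 < a) {m : ℕ → ℕ} {u : ℕ → ℂ} {ω : ℂ}
    (hmu : Tendsto (fun n => m n * u n) atTop (𝓝 ω)) (hu : Tendsto u atTop (𝓝 0)) :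
    Tendsto (fun n => jacobiSum a (m n) (u n)) atTop (𝓝 (kummer a (-ω))) :=
  tendsto_powerSum_ascPochhammer zero_le_one (norm_kummerCoeff_le ha) hmu hu

theorem tendsto_jacobiEuler {a : ℝ} (ha : 0 < a) {m : ℕ → ℕ} {u : ℕ → ℂ} {ω : ℂ}
    (hmu : Tendsto (fun n => m n * u n) atTop (𝓝 ω)) (hu : Tendsto u atTop (𝓝 0)) :
    Tendsto (fun n => jacobiEuler a (m n) (u n)) atTop (𝓝 (-ω * (kummerMid a (-ω) / 2))) := by
  have h := tendsto_powerSum_ascPochhammer (by norm_num : (0 : ℝ) ≤ 2 * 1)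
    (norm_natCast_mul_coeff_le zero_le_one (norm_kummerCoeff_le ha)) hmu hu
  rw [← mul_powerSum_shifted zero_le_one (norm_kummerCoeff_le ha),
    ← (hasDerivAt_kummer ha (-ω)).unique
      (hasDerivAt_powerSum zero_le_one (norm_kummerCoeff_le ha) (-ω))] at h
  exact h

theorem tendsto_inv_one_add_natCast_mul {x : ℝ} (hx : 0 < x) :
    Tendsto (fun N : ℕ => 2 / (1 + Complex.I * ((N * x : ℝ) : ℂ))) atTop (𝓝 0) ∧
    Tendsto (fun N : ℕ => (N : ℂ) * (2 / (1 + Complex.I * ((N * x : ℝ) : ℂ)))) atTop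
      (𝓝 (-(2 * Complex.I * ((1 / x : ℝ) : ℂ)))) := by
  have hinv : Tendsto (fun N : ℕ => ((N : ℂ))⁻¹) atTop (𝓝 0) := tendsto_inv_atTop_nhds_zero_nat
  have hx0 : (x : ℂ) ≠ 0 := by exact_mod_cast hx.ne'
  have h1 : Tendsto (fun N : ℕ => 2 / (((N : ℂ))⁻¹ + Complex.I * x)) atTop
      (𝓝 (2 / (0 + Complex.I * x))) :=
    tendsto_const_nhds.div (hinv.add_const _) (by simp [hx0])
  have h2 : Tendsto (fun N : ℕ => (N : ℂ) * (2 / (1 + Complex.I * ((N * x : ℝ) : ℂ)))) atTop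
      (𝓝 (-(2 * Complex.I * ((1 / x : ℝ) : ℂ)))) := by
    have e : -(2 * Complex.I * ((1 / x : ℝ) : ℂ)) = 2 / (0 + Complex.I * x) := by
      push_cast
      field_simp
      linear_combination (-(x : ℂ)) * Complex.I_sq
    rw [e]
    refine h1.congr' ?_
    filter_upwards [eventually_ne_atTop 0] with N hN
    have hN : (N : ℂ) ≠ 0 := by exact_mod_cast hN
    have h3 := one_add_I_mul_ne_zero (N * x)
    have h4 : ((N : ℂ))⁻¹ + Complex.I * x = (1 + Complex.I * ((N * x : ℝ) : ℂ)) / N := by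
      push_cast; field_simp
    rw [h4]
    field_simp
  refine ⟨?_, h2⟩
  have h3 := hinv.mul h2
  rw [zero_mul] at h3
  refine h3.congr' ?_
  filter_upwards [eventually_ne_atTop 0] with N hN
  have hN : (N : ℂ) ≠ 0 := by exact_mod_cast hN
  rw [inv_mul_cancel_left₀ hN]

theorem tendsto_jacobi_wronskian {s x : ℝ} (hs : 1 / 2 < s) (hx : 0 < x) :
    Tendsto (fun N : ℕ =>
      jacobiSum (s + 1) (N - 1) (2 / (1 + Complex.I * ((N * x : ℝ) : ℂ))) *
          jacobiSum s N (2 / (1 + Complex.I * ((N * x : ℝ) : ℂ)))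
        - jacobiSum (s + 1) (N - 1) (2 / (1 + Complex.I * ((N * x : ℝ) : ℂ))) *
          jacobiEuler s N (2 / (1 + Complex.I * ((N * x : ℝ) : ℂ)))
        + jacobiSum s N (2 / (1 + Complex.I * ((N * x : ℝ) : ℂ))) *
          jacobiEuler (s + 1) (N - 1) (2 / (1 + Complex.I * ((N * x : ℝ) : ℂ)))) atTop
      (𝓝 (Complex.exp (2 * (Complex.I * ((1 / x : ℝ) : ℂ))) * besselKernel s (1 / x))) := by
  have hs0 : 0 < s := by linarith
  have hs1 : 0 < s + 1 := by linarith
  obtain ⟨hu, hmu⟩ := tendsto_inv_one_add_natCast_mul hx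
  have hmu' : Tendsto (fun N : ℕ => ((N - 1 : ℕ) : ℂ) *
      (2 / (1 + Complex.I * ((N * x : ℝ) : ℂ)))) atTop
      (𝓝 (-(2 * Complex.I * ((1 / x : ℝ) : ℂ)))) := by
    have h := hmu.sub hu
    rw [sub_zero] at h
    refine h.congr' ?_
    filter_upwards [eventually_ge_atTop 1] with N hN
    push_cast [Nat.cast_sub hN]
    ring
  have h := (((tendsto_jacobiSum hs1 hmu' hu).mul (tendsto_jacobiSum hs0 hmu hu)).sub
    ((tendsto_jacobiSum hs1 hmu' hu).mul (tendsto_jacobiEuler hs0 hmu hu))).add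
    ((tendsto_jacobiSum hs0 hmu hu).mul (tendsto_jacobiEuler hs1 hmu' hu))
  refine h.trans (le_of_eq ?_)
  congr 1
  -- The contiguous relations remove `kummerMid`, leaving a quadratic form in `kummer s` and `kummer
  -- (s + 1)`, to which Kummer's formula applies.
  rw [neg_neg, mul_deriv_kummer hs0]
  have h1 := kummerMid_sub_kummer hs0 (2 * Complex.I * ((1 / x : ℝ) : ℂ))
  rw [sub_eq_iff_eq_add] at h1
  rw [h1]
  obtain ⟨e1, e2⟩ := kummer_eq_exp_mul_normBessel hs (one_div_pos.2 hx)
  rw [e1, e2, besselKernel, two_mul (Complex.I * _), Complex.exp_add]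
  have hc0 : (2 * (s : ℂ) + 1) ≠ 0 := by norm_cast; positivity
  generalize (1 / x) = z
  push_cast
  field_simp
  ring_nf
  simp only [Complex.I_sq]
  ring

/-- Euler's product `Real.GammaSeq t N` contains the factors t, …, t + N, one more than Γ(t+N)/Γ(t);
the extra one accounts for t/N + 1. -/
theorem tendsto_Gamma_ratio {t : ℝ} (ht : 0 < t) :
    Tendsto (fun N : ℕ => Real.Gamma (t + N) / (Real.Gamma N * (N : ℝ) ^ t)) atTop (𝓝 1) := by
  have hG := (Real.Gamma_pos_of_pos ht).ne'
  have h1 : Tendsto (fun N : ℕ => Real.Gamma t / Real.GammaSeq t N) atTop (𝓝 1) := by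
    have := (tendsto_const_nhds (x := Real.Gamma t)).div (Real.GammaSeq_tendsto_Gamma t) hG
    rwa [div_self hG] at this
  have h2 : Tendsto (fun N : ℕ => 1 / (t / N + 1)) atTop (𝓝 1) := by
    have h : Tendsto (fun N : ℕ => t / (N : ℝ) + 1) atTop (𝓝 (0 + 1)) :=
      (tendsto_const_div_atTop_nhds_zero_nat t).add_const 1
    have := (tendsto_const_nhds (x := (1 : ℝ))).div h (by norm_num)
    rw [zero_add, div_one] at this
    exact this
  have h3 := h1.mul h2
  rw [one_mul] at h3
  refine h3.congr' ?_
  filter_upwards [eventually_gt_atTop 0] with N hN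
  have hprod (n : ℕ) : ∏ j ∈ Finset.range n, (t + j) = rising t n := by
    induction n with
    | zero => simp
    | succ n ih => rw [Finset.prod_range_succ, ih, rising_succ]
  obtain ⟨n, rfl⟩ := Nat.exists_eq_succ_of_ne_zero hN.ne'
  have hp := (rising_pos ht (n + 1)).ne'
  have : (0 : ℝ) < ((n + 1 : ℕ) : ℝ) ^ t := by positivity
  rw [Real.GammaSeq, hprod, Nat.succ_eq_add_one, rising_succ _ (n + 1), Gamma_add_natCast ht,
    Nat.cast_add_one n, Real.Gamma_nat_eq_factorial, Nat.factorial_succ]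
  rw [Nat.cast_add_one n] at this
  have h5 : t + ((n : ℝ) + 1) ≠ 0 := by positivity
  have h6 : t / ((n : ℝ) + 1) + 1 = (t + (n + 1)) / (n + 1) := by field_simp
  rw [h6]
  push_cast
  field_simp

theorem tendsto_one_sub_pow {z : ℂ} :
    Tendsto (fun N : ℕ => (1 - z / N) ^ (2 * (N - 1))) atTop (𝓝 (Complex.exp (-(2 * z)))) := by
  have h1 : Tendsto (fun N : ℕ => (1 - z / N) ^ N) atTop (𝓝 (Complex.exp (-z))) := by
    refine (Complex.tendsto_one_add_div_pow_exp (-z)).congr fun N => ?_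
    rw [neg_div, sub_eq_add_neg]
  have h2 : Tendsto (fun N : ℕ => 1 - z / N) atTop (𝓝 1) := by
    simpa using (tendsto_const_div_atTop_nhds_zero_nat z).const_sub 1
  have h3 := (h1.pow 2).div (h2.pow 2) (by norm_num)
  rw [one_pow, div_one, ← Complex.exp_nat_mul] at h3
  have e : ((2 : ℕ) : ℂ) * -z = -(2 * z) := by push_cast; ring
  rw [e] at h3
  refine h3.congr' ?_
  filter_upwards [h2.eventually_ne one_ne_zero, eventually_ge_atTop 1] with N hN hN1
  obtain ⟨n, rfl⟩ := Nat.exists_eq_add_of_le' hN1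
  change ((1 - z / (n + 1 : ℕ)) ^ (n + 1)) ^ 2 / (1 - z / (n + 1 : ℕ)) ^ 2 = _
  rw [div_eq_iff (pow_ne_zero _ hN), Nat.add_sub_cancel]
  ring

theorem tendsto_weight_factor (s z : ℝ) :
    Tendsto (fun N : ℕ => (1 + (z / N) ^ 2) ^ (-(N : ℝ) - s)) atTop (𝓝 1) := by
  have h0 : Tendsto (fun N : ℕ => z / (N : ℝ)) atTop (𝓝 0) := tendsto_const_div_atTop_nhds_zero_nat z
  have h1 : Tendsto (fun N : ℕ => (1 + (z / N) ^ 2) ^ N) atTop (𝓝 1) := by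
    suffices h : Tendsto (fun N : ℕ => (1 + (z / N) ^ 2) ^ N) atTop (𝓝 (Real.exp 0)) by
      rwa [Real.exp_zero] at h
    refine Real.tendsto_one_add_pow_exp_of_tendsto ?_
    have h2 := h0.const_mul z
    rw [mul_zero] at h2
    refine h2.congr' ?_
    filter_upwards [eventually_ne_atTop 0] with N hN
    have hN : (N : ℝ) ≠ 0 := by exact_mod_cast hN
    field_simp
  have h2 : Tendsto (fun N : ℕ => (1 + (z / N) ^ 2) ^ s) atTop (𝓝 1) := by
    have h3 : Tendsto (fun N : ℕ => 1 + (z / N) ^ 2) atTop (𝓝 1) := by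
      simpa using (h0.pow 2).const_add 1
    simpa using h3.rpow_const (p := s) (Or.inl one_ne_zero)
  have h3 := (h1.mul h2).inv₀ (by norm_num)
  rw [one_mul, inv_one] at h3
  refine h3.congr fun N => ?_
  have : 0 < 1 + (z / N) ^ 2 := by positivity
  rw [← Real.rpow_natCast, ← Real.rpow_add this, ← Real.rpow_neg this.le]
  congr 1
  ring

theorem scaledDensity_eq {s x : ℝ} (hs : 0 < s) (hx : 0 < x) {N : ℕ} (hN : 2 ≤ N) :
    scaledDensity s N x =
      ((2 ^ (2 * s) / Real.pi * ((Real.Gamma (s + 1) * Real.Gamma (s + 1)) /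
        (Real.Gamma (2 * s + 1) * Real.Gamma (2 * s + 2))) * x ^ (-2 * s - 2) : ℝ) : ℂ) *
      ((Real.Gamma (2 * s + 1 + N) / (Real.Gamma N * (N : ℝ) ^ (2 * s + 1)) : ℝ) : ℂ) *
      (((1 + (1 / x / N) ^ 2) ^ (-(N : ℝ) - s) : ℝ) : ℂ) *
      (1 - Complex.I * ((1 / x : ℝ) : ℂ) / N) ^ (2 * (N - 1)) *
      (jacobiSum (s + 1) (N - 1) (2 / (1 + Complex.I * ((N * x : ℝ) : ℂ))) *
          jacobiSum s N (2 / (1 + Complex.I * ((N * x : ℝ) : ℂ)))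
        - jacobiSum (s + 1) (N - 1) (2 / (1 + Complex.I * ((N * x : ℝ) : ℂ))) *
          jacobiEuler s N (2 / (1 + Complex.I * ((N * x : ℝ) : ℂ)))
        + jacobiSum s N (2 / (1 + Complex.I * ((N * x : ℝ) : ℂ))) *
          jacobiEuler (s + 1) (N - 1) (2 / (1 + Complex.I * ((N * x : ℝ) : ℂ)))) := by
  rw [scaledDensity, onePointDensity, pseudoJacobi_wronskian hs hN]
  generalize (jacobiSum (s + 1) (N - 1) (2 / (1 + Complex.I * ((N * x : ℝ) : ℂ))) *
          jacobiSum s N (2 / (1 + Complex.I * ((N * x : ℝ) : ℂ)))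
        - jacobiSum (s + 1) (N - 1) (2 / (1 + Complex.I * ((N * x : ℝ) : ℂ))) *
          jacobiEuler s N (2 / (1 + Complex.I * ((N * x : ℝ) : ℂ)))
        + jacobiSum s N (2 / (1 + Complex.I * ((N * x : ℝ) : ℂ))) *
          jacobiEuler (s + 1) (N - 1) (2 / (1 + Complex.I * ((N * x : ℝ) : ℂ)))) = W
  have hN0 : (0 : ℝ) < N := by positivity
  have hx0 : (x : ℂ) ≠ 0 := by exact_mod_cast hx.ne'
  have hNC : (N : ℂ) ≠ 0 := by exact_mod_cast hN0.ne'
  have e1 : ((N * x : ℝ) : ℂ) - Complex.I =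
      ((N * x : ℝ) : ℂ) * (1 - Complex.I * ((1 / x : ℝ) : ℂ) / N) := by
    push_cast; field_simp
  have e2 : weight s N (N * x) =
      (N * x) ^ (-2 * (N : ℝ) - 2 * s) * (1 + (1 / x / N) ^ 2) ^ (-(N : ℝ) - s) := by
    have h1 : 1 + (N * x) ^ 2 = (N * x) ^ 2 * (1 + (1 / x / N) ^ 2) := by field_simp; ring
    rw [weight, h1, Real.mul_rpow (by positivity) (by positivity), ← Real.rpow_natCast,
      ← Real.rpow_mul (by positivity)]
    congr 2
    push_cast; ring
  -- The powers of N add up to N^(-2s-1), the exact normalization of Γ(2s+1+N)/Γ(N).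
  have e3 : (N : ℝ) * (N * x) ^ (2 * (N - 1)) * (N * x) ^ (-2 * (N : ℝ) - 2 * s) =
      x ^ (-2 * s - 2) / (N : ℝ) ^ (2 * s + 1) := by
    have h1 : (((2 * (N - 1) : ℕ)) : ℝ) = 2 * (N : ℝ) - 2 := by
      push_cast [Nat.cast_sub (show 1 ≤ N by omega)]; ring
    rw [mul_assoc, ← Real.rpow_natCast, ← Real.rpow_add (by positivity), h1,
      Real.mul_rpow hN0.le hx.le, div_eq_mul_inv, ← Real.rpow_neg hN0.le, ← mul_assoc]
    nth_rewrite 1 [← Real.rpow_one (N : ℝ)]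
    rw [← Real.rpow_add hN0, mul_comm (x ^ _)]
    congr 2 <;> ring
  have e4 : gammaSq s N = 2 ^ (2 * s) / Real.pi * ((Real.Gamma (s + 1) * Real.Gamma (s + 1)) /
        (Real.Gamma (2 * s + 1) * Real.Gamma (2 * s + 2))) *
        (Real.Gamma (2 * s + 1 + N) / Real.Gamma N) := by
    rw [gammaSq, show 2 * s + N + 1 = 2 * s + 1 + (N : ℝ) by ring]
    simp only [div_eq_mul_inv, mul_inv]
    ring
  rw [e1, mul_pow, e2, e4]
  have e5 : ((N : ℂ) * ((N * x : ℝ) : ℂ) ^ (2 * (N - 1))) *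
      (((N * x) ^ (-2 * (N : ℝ) - 2 * s) : ℝ) : ℂ) =
      ((x ^ (-2 * s - 2) / (N : ℝ) ^ (2 * s + 1) : ℝ) : ℂ) := by
    rw [← e3]; push_cast; ring
  simp only [Complex.ofReal_mul, Complex.ofReal_div] at e5 ⊢
  simp only [div_eq_mul_inv, mul_inv] at e5 ⊢
  linear_combination ((2 ^ (2 * s) : ℝ) : ℂ) * (Real.pi : ℂ)⁻¹ *
    ((Real.Gamma (s + 1) : ℂ) * Real.Gamma (s + 1) *
    ((Real.Gamma (2 * s + 1) : ℂ)⁻¹ * (Real.Gamma (2 * s + 2) : ℂ)⁻¹)) *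
    ((Real.Gamma (2 * s + 1 + N) : ℂ) * (Real.Gamma N : ℂ)⁻¹) *
    (((1 + ((1 : ℝ) * x⁻¹ * (N : ℝ)⁻¹) ^ 2) ^ (-(N : ℝ) - s) : ℝ) : ℂ) *
    (1 - Complex.I * (((1 : ℝ) : ℂ) * (x : ℂ)⁻¹) * (N : ℂ)⁻¹) ^ (2 * (N - 1)) * W * e5

theorem tendsto_scaledDensity {s x : ℝ} (hs : 1 / 2 < s) (hx : 0 < x) :
    Tendsto (fun N : ℕ => scaledDensity s N x) atTop
      (𝓝 ((2 ^ (2 * s) / Real.pi * ((Real.Gamma (s + 1) * Real.Gamma (s + 1)) /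
        (Real.Gamma (2 * s + 1) * Real.Gamma (2 * s + 2))) * x ^ (-2 * s - 2) *
          besselKernel s (1 / x) : ℝ) : ℂ)) := by
  have hs0 : 0 < s := by linarith
  set K : ℝ := 2 ^ (2 * s) / Real.pi * ((Real.Gamma (s + 1) * Real.Gamma (s + 1)) /
        (Real.Gamma (2 * s + 1) * Real.Gamma (2 * s + 2))) * x ^ (-2 * s - 2) with hK
  have h1 := (Complex.continuous_ofReal.tendsto _).comp
    (tendsto_Gamma_ratio (show 0 < 2 * s + 1 by linarith))
  have h2 := (Complex.continuous_ofReal.tendsto _).comp (tendsto_weight_factor s (1 / x))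
  have h3 := tendsto_one_sub_pow (z := Complex.I * ((1 / x : ℝ) : ℂ))
  have h4 := ((((tendsto_const_nhds (x := (K : ℂ))).mul h1).mul h2).mul h3).mul
    (tendsto_jacobi_wronskian hs hx)
  -- The phase from (x-i)^(2(N-1)) cancels the one from Kummer's formula, so the limit is real.
  have e : (K : ℂ) * ((1 : ℝ) : ℂ) * ((1 : ℝ) : ℂ) *
      Complex.exp (-(2 * (Complex.I * ((1 / x : ℝ) : ℂ)))) *
      (Complex.exp (2 * (Complex.I * ((1 / x : ℝ) : ℂ))) * besselKernel s (1 / x)) =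
      ((K * besselKernel s (1 / x) : ℝ) : ℂ) := by
    rw [Complex.ofReal_one, mul_one, mul_one, mul_assoc, ← mul_assoc (Complex.exp _),
      ← Complex.exp_add]
    simp
  rw [e] at h4
  refine h4.congr' ?_
  filter_upwards [eventually_ge_atTop 2] with N hN
  rw [scaledDensity_eq hs0 hx hN]
  rfl

end Limit

/-! ### The limit as a Wronskian of Bessel functions. -/

section LimitDensity

theorem besselJ_eq {b x : ℝ} (hb : 0 < b) (hx : 0 < x) :
    besselJ (b - 1) x = (x / 2) ^ (b - 1) / Real.Gamma b * normBessel b x := by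
  rw [besselJ, normBessel, hyp01, powerSum, ← tsum_mul_left]
  refine tsum_congr fun k => ?_
  have h1 := Real.Gamma_pos_of_pos hb
  have h2 := rising_pos hb k
  have h3 : (-(x ^ 2 / 4)) ^ k = (-1) ^ k * (x / 2) ^ (2 * (k : ℝ)) := by
    rw [show (2 * (k : ℝ)) = ((2 * k : ℕ) : ℝ) by push_cast; ring, Real.rpow_natCast, pow_mul,
      ← mul_pow]
    congr 1; ring
  rw [show (k : ℝ) + (b - 1) + 1 = b + k by ring, Gamma_add_natCast hb, h3,
    Real.rpow_add (by positivity)]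
  field_simp

theorem limitP_eq {s x : ℝ} (hs : 0 < s) (hx : 0 < x) :
    limitP s x = 2 ^ s * (x ^ (-s) * normBessel (s + 1 / 2) (1 / x)) := by
  have hb : 0 < s + 1 / 2 := by linarith
  have h1 := (Real.Gamma_pos_of_pos hb).ne'
  rw [limitP, show s - 1 / 2 = s + 1 / 2 - 1 by ring, besselJ_eq hb (by positivity)]
  have h2 : (1 / x / 2) ^ (s + 1 / 2 - 1) = 2 ^ (-(s - 1 / 2)) * x ^ (-(s - 1 / 2)) := by
    rw [← Real.mul_rpow zero_le_two hx.le, Real.rpow_neg (by positivity),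
      ← Real.inv_rpow (by positivity)]
    congr 1
    · field_simp
    · ring
  have h3 : (2 : ℝ) ^ s = 2 ^ (2 * s - 1 / 2) * 2 ^ (-(s - 1 / 2)) := by
    rw [← Real.rpow_add two_pos]; congr 1; ring
  have h4 : x ^ (-s) = x ^ (-(1 / 2 : ℝ)) * x ^ (-(s - 1 / 2)) := by
    rw [← Real.rpow_add hx]; congr 1; ring
  rw [h2, h3, h4]
  field_simp

theorem limitQ_eq {s x : ℝ} (hs : 0 < s) (hx : 0 < x) :
    limitQ s x = 2 ^ (s + 1) * (x ^ (-s - 1) * normBessel (s + 1 / 2 + 1) (1 / x)) := by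
  have hb : 0 < s + 1 / 2 + 1 := by linarith
  have h1 := (Real.Gamma_pos_of_pos hb).ne'
  rw [limitQ, show s + 3 / 2 = s + 1 / 2 + 1 by ring]
  nth_rewrite 2 [show s + 1 / 2 = s + 1 / 2 + 1 - 1 by ring]
  rw [besselJ_eq hb (by positivity)]
  have h2 : (1 / x / 2) ^ (s + 1 / 2 + 1 - 1) = 2 ^ (-(s + 1 / 2)) * x ^ (-(s + 1 / 2)) := by
    rw [← Real.mul_rpow zero_le_two hx.le, Real.rpow_neg (by positivity),
      ← Real.inv_rpow (by positivity)]
    congr 1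
    · field_simp
    · ring
  have h3 : (2 : ℝ) ^ (s + 1) = 2 ^ (2 * s + 3 / 2) * 2 ^ (-(s + 1 / 2)) := by
    rw [← Real.rpow_add two_pos]; congr 1; ring
  have h4 : x ^ (-s - 1) = x ^ (-(1 / 2 : ℝ)) * x ^ (-(s + 1 / 2)) := by
    rw [← Real.rpow_add hx]; congr 1; ring
  rw [h2, h3, h4]
  field_simp

/-- P and Q are power multiples of F(1/x) and G(1/x). Differentiating through the closed system for
F and G produces no third Bessel function. -/
theorem wronskian_limitQ_limitP {s x : ℝ} (hs : 1 / 2 < s) (hx : 0 < x) :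
    wronskian (limitQ s) (limitP s) x =
      2 ^ (2 * s + 1) * x ^ (-2 * s - 2) * besselKernel s (1 / x) := by
  have hs0 : 0 < s := by linarith
  have hb : 1 ≤ s + 1 / 2 := by linarith
  have hz : (1 / x) ≠ 0 := by positivity
  have hinv : HasDerivAt (fun x : ℝ => 1 / x) (-(x ^ 2)⁻¹) x := by
    simpa using hasDerivAt_inv hx.ne'
  have hP : HasDerivAt (limitP s) _ x :=
    (((Real.hasDerivAt_rpow_const (p := -s) (Or.inl hx.ne')).mul
      ((hasDerivAt_normBessel hb (1 / x)).comp x hinv)).const_mul (2 ^ s)).congr_of_eventuallyEq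
      ((eventually_gt_nhds hx).mono fun t ht => limitP_eq hs0 ht)
  have hQ : HasDerivAt (limitQ s) _ x :=
    (((Real.hasDerivAt_rpow_const (p := -s - 1) (Or.inl hx.ne')).mul
      ((hasDerivAt_normBessel_add_one hb hz).comp x hinv)).const_mul
        (2 ^ (s + 1))).congr_of_eventuallyEq
      ((eventually_gt_nhds hx).mono fun t ht => limitQ_eq hs0 ht)
  rw [wronskian, hP.deriv, hQ.deriv, limitP_eq hs0 hx, limitQ_eq hs0 hx, besselKernel]
  have e1 : x ^ (-s) = x ^ (-s - 1) * x := by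
    rw [Real.rpow_sub_one hx.ne']; field_simp
  have e2 : x ^ (-s - 1 - 1) = x ^ (-s - 1) / x := Real.rpow_sub_one hx.ne' _
  have e3 : (2 : ℝ) ^ (2 * s + 1) = 2 ^ s * 2 ^ (s + 1) := by
    rw [← Real.rpow_add two_pos]; congr 1; ring
  have e4 : x ^ (-2 * s - 2) = x ^ (-s - 1) * x ^ (-s - 1) := by
    rw [← Real.rpow_add hx]; congr 1; ring
  have hc : 2 * (s + 1 / 2) = 2 * s + 1 := by ring
  rw [e1, e2, e3, e4, hc]
  simp only [Function.comp]
  have : 2 * s + 1 ≠ 0 := by positivity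
  field_simp
  ring

theorem limitDensity_eq {s x : ℝ} (hs : 1 / 2 < s) (hx : 0 < x) :
    limitDensity s x = 2 ^ (2 * s) / Real.pi * ((Real.Gamma (s + 1) * Real.Gamma (s + 1)) /
        (Real.Gamma (2 * s + 1) * Real.Gamma (2 * s + 2))) * x ^ (-2 * s - 2) *
          besselKernel s (1 / x) := by
  rw [limitDensity, wronskian_limitQ_limitP hs hx, Real.rpow_add_one two_ne_zero]
  field_simp

end LimitDensity

/-! ### Decay of the kernel at infinity. -/

section Energy

/-- This equation drives both the decay estimate and the integration by parts for the moments. -/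
theorem hasDerivAt_besselKernel {s z : ℝ} (hs : 1 / 2 < s) (hz : z ≠ 0) :
    HasDerivAt (besselKernel s) (2 * s *
      (normBessel (s + 1 / 2) z * normBessel (s + 1 / 2 + 1) z - besselKernel s z) / z) z := by
  have hb : 1 ≤ s + 1 / 2 := by linarith
  have hF := hasDerivAt_normBessel hb z
  have hG := hasDerivAt_normBessel_add_one hb hz
  have hV := hasDerivAt_mul_normBessel hb z
  have h := (((hF.pow 2).const_mul (2 * s + 1)).sub ((hF.mul hG).const_mul (2 * s))).add
    ((hV.pow 2).div_const (2 * s + 1))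
  have e : besselKernel s = fun z => (2 * s + 1) * normBessel (s + 1 / 2) z ^ 2
    - 2 * s * (normBessel (s + 1 / 2) z * normBessel (s + 1 / 2 + 1) z)
    + (z * normBessel (s + 1 / 2 + 1) z) ^ 2 / (2 * s + 1) := by
    funext z; rw [besselKernel, mul_pow]
  rw [e]
  refine h.congr_deriv ?_
  have hc : 2 * (s + 1 / 2) = 2 * s + 1 := by ring
  have : 2 * s + 1 ≠ 0 := by positivity
  rw [hc]
  field_simp
  push_cast
  ring

theorem continuous_besselKernel {s : ℝ} (hs : 1 / 2 < s) : Continuous (besselKernel s) := by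
  have h1 := continuous_normBessel (show 1 ≤ s + 1 / 2 by linarith)
  have h2 := continuous_normBessel (show 1 ≤ s + 1 / 2 + 1 by linarith)
  unfold besselKernel
  fun_prop

/-- By the arithmetic-geometric mean inequality 2z|FG| is at most the diagonal part of the form. For
z ≥ 2s the cross term therefore costs at most half of that part. -/
theorem le_two_mul_besselKernel {s z : ℝ} (hs : 1 / 2 < s) (hz : 2 * s ≤ z) :
    (2 * s + 1) * normBessel (s + 1 / 2) z ^ 2
      + z ^ 2 * normBessel (s + 1 / 2 + 1) z ^ 2 / (2 * s + 1) ≤ 2 * besselKernel s z ∧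
    |normBessel (s + 1 / 2) z * normBessel (s + 1 / 2 + 1) z| ≤ besselKernel s z / z := by
  have hz0 : 0 < z := by linarith
  have hc : 0 < 2 * s + 1 := by linarith
  rw [besselKernel]
  set F := normBessel (s + 1 / 2) z
  set G := normBessel (s + 1 / 2 + 1) z
  have h1 : 2 * (z * |F * G|) ≤ (2 * s + 1) * F ^ 2 + z ^ 2 * G ^ 2 / (2 * s + 1) := by
    have h := two_mul_le_add_sq (√(2 * s + 1) * |F|) (z * |G| / √(2 * s + 1))
    rw [mul_pow, div_pow, mul_pow, Real.sq_sqrt hc.le, sq_abs, sq_abs] at h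
    refine le_trans (le_of_eq ?_) h
    have : √(2 * s + 1) ≠ 0 := by positivity
    rw [abs_mul]
    field_simp
  have h2 : 2 * s * (F * G) ≤ z * |F * G| :=
    (mul_le_mul_of_nonneg_left (le_abs_self _) (by linarith)).trans
      (mul_le_mul_of_nonneg_right hz (abs_nonneg _))
  refine ⟨by linarith, ?_⟩
  rw [le_div_iff₀ hz0]
  linarith

/-- An energy argument: `z ^ (2 s)` times the kernel stays bounded. -/
theorem exists_besselKernel_le {s : ℝ} (hs : 1 / 2 < s) :
    ∃ C, ∀ z, 2 * s ≤ z → besselKernel s z ≤ C * z ^ (-(2 * s)) := by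
  have hs0 : 0 < s := by linarith
  -- The derivative of z^(2s)B is z^(2s)(2s/z)FG, at most (2s/z²) z^(2s)B when z ≥ 2s. The factor
  -- exp(2s/z), with logarithmic derivative -2s/z², absorbs this growth.
  have hE (z : ℝ) (hz : 0 < z) : HasDerivAt
      (fun z => z ^ (2 * s) * besselKernel s z * Real.exp (2 * s / z))
      (z ^ (2 * s) * Real.exp (2 * s / z) * (2 * s / z) *
        (normBessel (s + 1 / 2) z * normBessel (s + 1 / 2 + 1) z - besselKernel s z / z)) z := by
    have h1 : HasDerivAt (fun z : ℝ => 2 * s / z) (-(2 * s / z ^ 2)) z := by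
      simpa [div_eq_mul_inv] using (hasDerivAt_inv hz.ne').const_mul (2 * s)
    refine (((Real.hasDerivAt_rpow_const (p := 2 * s) (Or.inl hz.ne')).mul
      (hasDerivAt_besselKernel hs hz.ne')).mul h1.exp).congr_deriv ?_
    simp only [Pi.mul_apply]
    rw [Real.rpow_sub_one hz.ne']
    field_simp
    ring
  have hanti : AntitoneOn (fun z => z ^ (2 * s) * besselKernel s z * Real.exp (2 * s / z))
      (Set.Ici (2 * s)) := by
    have hpos (z : ℝ) (hz : z ∈ Set.Ici (2 * s)) : 0 < z := lt_of_lt_of_le (by linarith) hz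
    refine antitoneOn_of_deriv_nonpos (convex_Ici _)
      (fun t ht => (hE t (hpos t ht)).continuousAt.continuousWithinAt)
      (fun t ht => (hE t (hpos t (interior_subset ht))).differentiableAt.differentiableWithinAt)
      fun t ht => ?_
    have ht := interior_subset ht
    have h0 := hpos t ht
    rw [(hE t h0).deriv]
    refine mul_nonpos_of_nonneg_of_nonpos (by positivity) (sub_nonpos.2 ?_)
    exact (le_abs_self _).trans (le_two_mul_besselKernel hs ht).2
  refine ⟨(2 * s) ^ (2 * s) * besselKernel s (2 * s) * Real.exp (2 * s / (2 * s)), fun z hz => ?_⟩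
  have h := hanti Set.self_mem_Ici hz hz
  have hz0 : 0 < z := by linarith
  have hB : 0 ≤ besselKernel s z := by
    have := (le_two_mul_besselKernel hs hz).1
    have h2 : 0 ≤ (2 * s + 1) * normBessel (s + 1 / 2) z ^ 2
      + z ^ 2 * normBessel (s + 1 / 2 + 1) z ^ 2 / (2 * s + 1) := by positivity
    linarith
  rw [Real.rpow_neg hz0.le, ← div_eq_mul_inv, le_div_iff₀ (by positivity), mul_comm]
  refine le_trans ?_ h
  exact le_mul_of_one_le_right (by positivity) (Real.one_le_exp (by positivity))

theorem isBigO_besselKernel {s : ℝ} (hs : 1 / 2 < s) :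
    besselKernel s =O[atTop] fun z : ℝ => z ^ (-(2 * s)) := by
  obtain ⟨C, hC⟩ := exists_besselKernel_le hs
  refine Asymptotics.IsBigO.of_bound C ?_
  filter_upwards [eventually_ge_atTop (2 * s)] with z hz
  have hz0 : 0 < z := by linarith
  have := (abs_nonneg _).trans (le_two_mul_besselKernel hs hz).2
  have hB : 0 ≤ besselKernel s z := by
    by_contra! h
    exact absurd this (not_le.2 (div_neg_of_neg_of_pos h hz0))
  rw [Real.norm_of_nonneg hB, Real.norm_of_nonneg (by positivity)]
  exact hC z hz

theorem isBigO_normBessel_mul {s : ℝ} (hs : 1 / 2 < s) :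
    (fun z => normBessel (s + 1 / 2) z * normBessel (s + 1 / 2 + 1) z) =O[atTop]
      fun z : ℝ => z ^ (-(2 * s)) := by
  refine Asymptotics.IsBigO.trans ?_ (isBigO_besselKernel hs)
  refine Asymptotics.IsBigO.of_bound 1 ?_
  filter_upwards [eventually_ge_atTop (2 * s)] with z hz
  have hz0 : 1 ≤ z := by linarith
  have := (le_two_mul_besselKernel hs hz).2
  rw [one_mul, Real.norm_eq_abs, Real.norm_eq_abs]
  refine this.trans ((div_le_div_of_nonneg_right (le_abs_self _) (by linarith)).trans ?_)
  exact div_le_self (abs_nonneg _) hz0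

/-- With z = 2√w the kernel bound controls F(z)², hence the square root in the exponent. -/
theorem isBigO_hyp01_neg {s : ℝ} (hs : 1 / 2 < s) :
    (fun w => hyp01 (s + 1 / 2) (-w)) =O[atTop] fun w : ℝ => w ^ (-(s / 2)) := by
  obtain ⟨C, hC⟩ := exists_besselKernel_le hs
  refine Asymptotics.IsBigO.of_bound (√(2 * C * 4 ^ (-s))) ?_
  filter_upwards [eventually_ge_atTop (s ^ 2)] with w hw
  have hw0 : 0 < w := lt_of_lt_of_le (by positivity) hw
  have hz : 2 * s ≤ 2 * √w := by
    have := Real.le_sqrt_of_sq_le hw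
    linarith
  have h1 := (le_two_mul_besselKernel hs hz).1
  have h2 := hC _ hz
  have e : hyp01 (s + 1 / 2) (-w) = normBessel (s + 1 / 2) (2 * √w) := by
    rw [normBessel, mul_pow, Real.sq_sqrt hw0.le]; congr 1; ring
  have e2 : (2 * √w) ^ (-(2 * s)) = 4 ^ (-s) * w ^ (-s) := by
    rw [show -(2 * s) = 2 * (-s) by ring, Real.rpow_mul (by positivity), ← Real.mul_rpow (by norm_num) hw0.le]
    congr 1
    rw [Real.rpow_two, mul_pow, Real.sq_sqrt hw0.le]; norm_num
  rw [e2] at h2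
  have h3 : normBessel (s + 1 / 2) (2 * √w) ^ 2 ≤ 2 * C * 4 ^ (-s) * w ^ (-s) := by
    have h4 : 0 ≤ (2 * √w) ^ 2 * normBessel (s + 1 / 2 + 1) (2 * √w) ^ 2 / (2 * s + 1) := by
      positivity
    nlinarith [sq_nonneg (normBessel (s + 1 / 2) (2 * √w))]
  rw [e, Real.norm_eq_abs, Real.norm_of_nonneg (by positivity),
    show w ^ (-(s / 2)) = √(w ^ (-s)) by
      rw [Real.sqrt_eq_rpow, ← Real.rpow_mul hw0.le]; congr 1; ring,
    ← Real.sqrt_mul' _ (by positivity)]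
  exact Real.abs_le_sqrt h3

end Energy

/-! ### Mellin transforms of averages, Gamma and Beta densities. -/

section Mellin

theorem integrableOn_rpow_mul_of_isBigO {h : ℝ → ℝ} {a p : ℝ} (hc : Continuous h)
    (hO : h =O[atTop] fun w : ℝ => w ^ (-p)) (ha : 0 < a) (hp : a < p) :
    IntegrableOn (fun w : ℝ => w ^ (a - 1) * h w) (Set.Ioi 0) := by
  have hmeas : AEStronglyMeasurable h (volume.restrict (Set.Ioi 0)) := hc.aestronglyMeasurable
  obtain ⟨c1, hc1, i1⟩ := mellin_convergent_top_of_isBigO hmeas hO hp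
  have h0 : h =O[𝓝[>] 0] fun w : ℝ => w ^ (-(0 : ℝ)) := by
    simp only [neg_zero, Real.rpow_zero]
    exact (hc.tendsto 0).mono_left nhdsWithin_le_nhds |>.isBigO_one ℝ
  obtain ⟨c2, hc2, i2⟩ := mellin_convergent_zero_of_isBigO hmeas h0 ha
  have hcont : ContinuousOn (fun w : ℝ => w ^ (a - 1) * h w) (Set.Icc c2 c1) :=
    ContinuousOn.mul (fun w hw => (Real.continuousAt_rpow_const _ _
      (Or.inl (lt_of_lt_of_le hc2 hw.1).ne')).continuousWithinAt) hc.continuousOn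
  refine ((i2.union hcont.integrableOn_Icc).union i1).mono_set fun w hw => ?_
  have hw : 0 < w := hw
  rcases lt_or_ge w c2 with h1 | h1
  · exact Or.inl (Or.inl ⟨hw, h1.le⟩)
  · rcases le_or_gt w c1 with h2 | h2
    · exact Or.inl (Or.inr ⟨h1, h2⟩)
    · exact Or.inr h2

/-- The Mellin transform turns a multiplicative convolution into a product. -/
theorem integral_rpow_mul_average {φ h : ℝ → ℝ} {a : ℝ} (hφm : Measurable φ) (hhm : Measurable h)
    (hφ : IntegrableOn (fun v : ℝ => v ^ (-a) * φ v) (Set.Ioi 0))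
    (hh : IntegrableOn (fun w : ℝ => w ^ (a - 1) * h w) (Set.Ioi 0)) :
    ∫ w in Set.Ioi (0 : ℝ), w ^ (a - 1) * ∫ v in Set.Ioi (0 : ℝ), φ v * h (v * w) =
      (∫ v in Set.Ioi (0 : ℝ), v ^ (-a) * φ v) * ∫ w in Set.Ioi (0 : ℝ), w ^ (a - 1) * h w := by
  set k : ℝ → ℝ := fun w => w ^ (a - 1) * h w with hk
  set F : ℝ → ℝ → ℝ := fun w v => w ^ (a - 1) * (φ v * h (v * w)) with hF
  -- For fixed v the integrand is a dilate of k. Integrating in w gives the Jacobian 1/v, which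
  -- turns v^(1-a) into v^(-a).
  have hFeq (v : ℝ) (hv : v ∈ Set.Ioi (0 : ℝ)) (w : ℝ) (hw : w ∈ Set.Ioi (0 : ℝ)) :
      F w v = v ^ (1 - a) * φ v * k (v * w) := by
    have hv : 0 < v := hv
    have hw : 0 < w := hw
    simp only [hF, hk]
    have : v ^ (1 - a) * v ^ (a - 1) = 1 := by rw [← Real.rpow_add hv]; simp
    rw [Real.mul_rpow hv.le hw.le]
    linear_combination (-(w ^ (a - 1) * φ v * h (v * w))) * this
  have hrp (v : ℝ) (hv : v ∈ Set.Ioi (0 : ℝ)) : v ^ (1 - a) * v⁻¹ = v ^ (-a) := by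
    have hv : 0 < v := hv
    rw [← Real.rpow_neg_one v, ← Real.rpow_add hv]; congr 1; ring
  have hslice (v : ℝ) (hv : v ∈ Set.Ioi (0 : ℝ)) :
      ∫ w in Set.Ioi (0 : ℝ), F w v = v ^ (-a) * φ v * ∫ w in Set.Ioi (0 : ℝ), k w := by
    rw [setIntegral_congr_fun measurableSet_Ioi (hFeq v hv), integral_const_mul,
      integral_comp_mul_left_Ioi k 0 hv, mul_zero, smul_eq_mul, ← hrp v hv]
    ring
  have hint : Integrable (Function.uncurry F)
      ((volume.restrict (Set.Ioi (0 : ℝ))).prod (volume.restrict (Set.Ioi (0 : ℝ)))) := by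
    rw [integrable_prod_iff']
    · constructor
      · refine (ae_restrict_iff' measurableSet_Ioi).2 (ae_of_all _ fun v hv => ?_)
        have h1 : IntegrableOn (fun w => k (v * w)) (Set.Ioi 0) := by
          have := (integrableOn_Ioi_comp_mul_left_iff k 0 hv).2 (by rwa [mul_zero])
          exact this
        exact IntegrableOn.congr_fun (h1.const_mul (v ^ (1 - a) * φ v))
          (fun w hw => (hFeq v hv w hw).symm) measurableSet_Ioi
      · refine IntegrableOn.congr_fun
          (hφ.norm.mul_const (∫ w in Set.Ioi (0 : ℝ), ‖k w‖)) (fun v hv => ?_) measurableSet_Ioi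
        have hv0 : 0 < v := hv
        have h1 : Set.EqOn (fun w => ‖F w v‖) (fun w => ‖v ^ (1 - a) * φ v‖ * ‖k (v * w)‖)
            (Set.Ioi 0) := fun w hw => by
          simp only
          rw [hFeq v hv w hw, norm_mul]
        simp only [Function.uncurry_apply_pair]
        rw [setIntegral_congr_fun measurableSet_Ioi h1, integral_const_mul,
          integral_comp_mul_left_Ioi (fun w => ‖k w‖) 0 hv, mul_zero, smul_eq_mul, ← hrp v hv,
          norm_mul, norm_mul, norm_mul, Real.norm_of_nonneg (inv_pos.2 hv0).le]
        ring
    · refine Measurable.aestronglyMeasurable ?_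
      simp only [hF, Function.uncurry_def]
      fun_prop
  calc ∫ w in Set.Ioi (0 : ℝ), w ^ (a - 1) * ∫ v in Set.Ioi (0 : ℝ), φ v * h (v * w)
      = ∫ w in Set.Ioi (0 : ℝ), ∫ v in Set.Ioi (0 : ℝ), F w v := by
        simp only [hF, integral_const_mul]
    _ = ∫ v in Set.Ioi (0 : ℝ), ∫ w in Set.Ioi (0 : ℝ), F w v := integral_integral_swap hint
    _ = _ := by
        rw [setIntegral_congr_fun measurableSet_Ioi hslice, integral_mul_const]

/-- Termwise integration of a power series against a nonnegative function with known moments. -/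
theorem integral_mul_powerSum {φ : ℝ → ℝ} {c m : ℕ → ℝ} {w : ℝ} (hφ0 : ∀ v ∈ Set.Ioi (0 : ℝ), 0 ≤ φ v)
    (hφ : ∀ k : ℕ, IntegrableOn (fun v => φ v * v ^ k) (Set.Ioi 0))
    (hm : ∀ k : ℕ, ∫ v in Set.Ioi (0 : ℝ), φ v * v ^ k = m k)
    (hs : Summable fun k => |c k * m k * w ^ k|) :
    ∫ v in Set.Ioi (0 : ℝ), φ v * powerSum c (v * w) = powerSum (fun k => c k * m k) w := by
  have h := integral_tsum_of_summable_integral_norm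
    (μ := volume.restrict (Set.Ioi (0 : ℝ))) (F := fun k v => φ v * v ^ k * (c k * w ^ k))
    (fun k => (hφ k).mul_const _) ?_
  · simp only [integral_mul_const, hm] at h
    rw [powerSum]
    have e : ∑' k, c k * m k * w ^ k = ∑' k, m k * (c k * w ^ k) :=
      tsum_congr fun k => by ring
    rw [e, h]
    refine integral_congr_ae (ae_of_all _ fun v => ?_)
    simp only [powerSum, ← tsum_mul_left]
    exact tsum_congr fun k => by ring
  · refine hs.congr fun k => ?_
    have h0 : 0 ≤ m k := by
      rw [← hm]
      refine setIntegral_nonneg measurableSet_Ioi fun v hv => ?_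
      have hv0 : 0 < v := hv
      have := hφ0 v hv
      positivity
    have : ∫ v in Set.Ioi (0 : ℝ), ‖φ v * v ^ k * (c k * w ^ k)‖ =
        ∫ v in Set.Ioi (0 : ℝ), φ v * v ^ k * |c k * w ^ k| := by
      refine setIntegral_congr_fun measurableSet_Ioi fun v hv => ?_
      have hv0 : 0 < v := hv
      have := hφ0 v hv
      simp only [norm_mul _ (c k * w ^ k), Real.norm_eq_abs]
      rw [abs_of_nonneg (show 0 ≤ φ v * v ^ k by positivity)]
    rw [this, integral_mul_const, hm, mul_right_comm, abs_mul, abs_of_nonneg h0, mul_comm]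

theorem integral_rpow_mul_exp_neg {p : ℝ} (hp : 0 < p) :
    ∫ v in Set.Ioi (0 : ℝ), v ^ (p - 1) * Real.exp (-v) = Real.Gamma p := by
  rw [Real.Gamma_eq_integral hp]
  simp only [mul_comm]

theorem integrableOn_rpow_mul_exp_neg {p : ℝ} (hp : 0 < p) :
    IntegrableOn (fun v : ℝ => v ^ (p - 1) * Real.exp (-v)) (Set.Ioi 0) := by
  simpa only [mul_comm] using Real.GammaIntegral_convergent hp

theorem powerSum_inv_factorial (w : ℝ) :
    powerSum (fun k : ℕ => 1 / (k.factorial : ℝ)) w = Real.exp w := by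
  rw [Real.exp_eq_exp_ℝ, NormedSpace.exp_eq_tsum_div, powerSum]
  exact tsum_congr fun k => by ring

/-- The moments Γ(b) `rising b k` of the Gamma density cancel the rising factorials in ₀F₁, leaving
the exponential series. -/
theorem integral_rpow_mul_exp_neg_mul_hyp01 {b : ℝ} (hb : 0 < b) (w : ℝ) :
    ∫ v in Set.Ioi (0 : ℝ), v ^ (b - 1) * Real.exp (-v) * hyp01 b (-(v * w)) =
      Real.Gamma b * Real.exp (-w) := by
  have hmom (k : ℕ) : Set.EqOn (fun v : ℝ => v ^ (b + k - 1) * Real.exp (-v))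
      (fun v : ℝ => v ^ (b - 1) * Real.exp (-v) * v ^ k) (Set.Ioi 0) := fun v hv => by
    have hv : 0 < v := hv
    simp only
    rw [show b + k - 1 = b - 1 + k by ring, Real.rpow_add hv, Real.rpow_natCast]
    ring
  have hcm (k : ℕ) : 1 / (k.factorial * rising b k) * (Real.Gamma b * rising b k) =
      Real.Gamma b * (1 / (k.factorial : ℝ)) := by
    have := (rising_pos hb k).ne'
    field_simp
  have h := integral_mul_powerSum (φ := fun v => v ^ (b - 1) * Real.exp (-v))
    (c := fun k => 1 / (k.factorial * rising b k)) (m := fun k => Real.Gamma b * rising b k)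
    (w := -w) (fun v hv => ?_) (fun k => ?_) (fun k => ?_) ?_
  · simp only [hcm, mul_neg] at h
    rw [powerSum_const_mul, powerSum_inv_factorial] at h
    exact h
  · have hv : 0 < v := hv
    positivity
  · exact (integrableOn_rpow_mul_exp_neg (show 0 < b + k by positivity)).congr_fun (hmom k)
      measurableSet_Ioi
  · rw [← Gamma_add_natCast hb, ← integral_rpow_mul_exp_neg (by positivity)]
    exact (setIntegral_congr_fun measurableSet_Ioi (hmom k)).symm
  · simp only [hcm]
    refine (((Real.summable_pow_div_factorial (-w)).mul_left (Real.Gamma b)).abs).congr fun k => ?_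
    congr 1
    ring

/-- The Mellin transform of `₀F₁(; b; -w)`. -/
theorem integral_rpow_mul_hyp01 {b a : ℝ} (hb : 1 ≤ b) (ha : 0 < a) (hab : a < b)
    (hint : IntegrableOn (fun w : ℝ => w ^ (a - 1) * hyp01 b (-w)) (Set.Ioi 0)) :
    ∫ w in Set.Ioi (0 : ℝ), w ^ (a - 1) * hyp01 b (-w) =
      Real.Gamma a * Real.Gamma b / Real.Gamma (b - a) := by
  have hb0 : 0 < b := by linarith
  have hexp : Set.EqOn (fun v : ℝ => v ^ (b - a - 1) * Real.exp (-v))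
      (fun v : ℝ => v ^ (-a) * (v ^ (b - 1) * Real.exp (-v))) (Set.Ioi 0) := fun v hv => by
    have hv : 0 < v := hv
    simp only
    rw [← mul_assoc, ← Real.rpow_add hv]
    congr 2; ring
  have hcont := (continuous_hyp01 hb).measurable
  -- The averaged function is Γ(b)e^(-w), whose Mellin transform is Γ(b)Γ(a). It equals Γ(b-a) times
  -- the unknown integral, which is then solved for.
  have h := integral_rpow_mul_average (φ := fun v => v ^ (b - 1) * Real.exp (-v))
    (h := fun w => hyp01 b (-w)) (a := a) (by fun_prop) (by fun_prop)
    ((integrableOn_rpow_mul_exp_neg (by linarith : 0 < b - a)).congr_fun hexp measurableSet_Ioi) hint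
  rw [← setIntegral_congr_fun measurableSet_Ioi hexp,
    integral_rpow_mul_exp_neg (by linarith : 0 < b - a)] at h
  simp only [integral_rpow_mul_exp_neg_mul_hyp01 hb0] at h
  have h2 : ∫ w in Set.Ioi (0 : ℝ), w ^ (a - 1) * (Real.Gamma b * Real.exp (-w)) =
      Real.Gamma b * Real.Gamma a := by
    rw [← integral_rpow_mul_exp_neg ha, ← integral_const_mul]
    congr 1 with w
    ring
  rw [h2] at h
  have := (Real.Gamma_pos_of_pos (by linarith : 0 < b - a)).ne'
  rw [eq_div_iff this]
  linarith

/-- The density of Euler's Beta integral, extended by zero. -/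
def betaDensity (p q : ℝ) : ℝ → ℝ :=
  Set.indicator (Set.Ioo 0 1) fun v => v ^ (p - 1) * (1 - v) ^ (q - 1)

theorem measurable_betaDensity (p q : ℝ) : Measurable (betaDensity p q) :=
  Measurable.indicator (by fun_prop) measurableSet_Ioo

theorem betaDensity_nonneg (p q v : ℝ) : 0 ≤ betaDensity p q v := by
  refine Set.indicator_nonneg (fun v hv => ?_) v
  have h1 : 0 < v := hv.1
  have h2 : 0 < 1 - v := by linarith [hv.2]
  positivity

theorem rpow_mul_betaDensity (p q r : ℝ) {v : ℝ} (hv : 0 < v) :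
    v ^ r * betaDensity p q v = betaDensity (p + r) q v := by
  by_cases h : v ∈ Set.Ioo (0 : ℝ) 1
  · simp only [betaDensity, Set.indicator_of_mem h]
    rw [show p + r - 1 = r + (p - 1) by ring, Real.rpow_add hv]
    ring
  · simp [betaDensity, Set.indicator_of_notMem h]

theorem betaDensity_integrable_and_integral {p q : ℝ} (hp : 0 < p) (hq : 0 < q) :
    IntegrableOn (betaDensity p q) (Set.Ioi 0) ∧
      ∫ v in Set.Ioi (0 : ℝ), betaDensity p q v =
        Real.Gamma p * Real.Gamma q / Real.Gamma (p + q) := by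
  have e : Set.EqOn (fun v : ℝ => ((v ^ (p - 1) * (1 - v) ^ (q - 1) : ℝ) : ℂ))
      (fun v : ℝ => (v : ℂ) ^ ((p : ℂ) - 1) * (1 - (v : ℂ)) ^ ((q : ℂ) - 1)) (Set.Ioo 0 1) :=
    fun v hv => by
      simp only
      rw [Complex.ofReal_mul, Complex.ofReal_cpow hv.1.le, Complex.ofReal_cpow (by linarith [hv.2])]
      push_cast
      rfl
  have hi := (intervalIntegrable_iff_integrableOn_Ioo_of_le zero_le_one).1
    (Complex.betaIntegral_convergent (u := p) (v := q) (by simpa) (by simpa))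
  have hi2 : IntegrableOn (fun v : ℝ => v ^ (p - 1) * (1 - v) ^ (q - 1)) (Set.Ioo 0 1) := by
    have h := (hi.congr_fun e.symm measurableSet_Ioo).re
    simp only [RCLike.re_to_complex, Complex.ofReal_re] at h
    exact h
  have hsub : Set.Ioi (0 : ℝ) ∩ Set.Ioo 0 1 = Set.Ioo 0 1 :=
    Set.inter_eq_right.2 fun v hv => hv.1
  constructor
  · exact ((integrable_indicator_iff measurableSet_Ioo).2 hi2).integrableOn
  · rw [betaDensity, setIntegral_indicator measurableSet_Ioo, hsub]
    have h := Complex.betaIntegral_eq_Gamma_mul_div p q (by simpa) (by simpa)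
    rw [Complex.betaIntegral, intervalIntegral.integral_of_le zero_le_one,
      integral_Ioc_eq_integral_Ioo, ← setIntegral_congr_fun measurableSet_Ioo e,
      integral_complex_ofReal, ← Complex.ofReal_add, Complex.Gamma_ofReal, Complex.Gamma_ofReal,
      Complex.Gamma_ofReal] at h
    exact_mod_cast h

end Mellin

/-! ### The product of Bessel functions and the moments of the limit density. -/

section Moments

theorem hyp01_mul_hyp01 {b b' : ℝ} (hb : 1 ≤ b) (hb' : 1 ≤ b') (w : ℝ) :
    hyp01 b w * hyp01 b' w = powerSum (fun n : ℕ =>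
      rising (b + b' + n - 1) n / (n.factorial * rising b n * rising b' n)) w := by
  rw [hyp01, hyp01, powerSum, powerSum, tsum_mul_tsum_eq_tsum_sum_antidiagonal_of_summable_norm
    (summable_norm_powerSum zero_le_one (norm_hyp01_coeff_le hb) w)
    (summable_norm_powerSum zero_le_one (norm_hyp01_coeff_le hb') w), powerSum]
  refine tsum_congr fun n => ?_
  rw [← sum_antidiagonal_rising (by linarith) (by linarith), Finset.sum_mul]
  refine Finset.sum_congr rfl fun p hp => ?_
  rw [← Finset.HasAntidiagonal.mem_antidiagonal.1 hp, pow_add]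
  ring

/-- The coefficients of `₁F₂(s + 1; s + 3/2, 2 s + 1; ·)`. -/
def productCoeff (s : ℝ) (k : ℕ) : ℝ :=
  rising (s + 1) k / (k.factorial * rising (s + 1 / 2 + 1) k * rising (2 * s + 1) k)

theorem norm_productCoeff_le {s : ℝ} (hs : 0 < s) (k : ℕ) :
    ‖productCoeff s k‖ ≤ 1 ^ k / k.factorial := by
  have h1 := rising_pos (show 0 < s + 1 by linarith) k
  have h2 := one_le_rising (show 1 ≤ 2 * s + 1 by linarith) k
  have h3 := rising_mono (show 0 < s + 1 by linarith) (show s + 1 ≤ s + 1 / 2 + 1 by linarith) k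
  have h4 := h1.trans_le h3
  have h5 : (0 : ℝ) < k.factorial := by positivity
  rw [productCoeff, Real.norm_of_nonneg (by positivity), one_pow]
  rw [div_le_div_iff₀ (by positivity) h5]
  calc rising (s + 1) k * k.factorial ≤ rising (s + 1 / 2 + 1) k * k.factorial := by gcongr
    _ = 1 * (k.factorial * rising (s + 1 / 2 + 1) k * 1) := by ring
    _ ≤ _ := by gcongr

/-- Duplication of `rising (2 * s + 1) (2 * k)` rewrites the Vandermonde numerator: its 4^k cancels
the 1/4 in the Bessel argument, and its factor `rising (s + 1 / 2) k` cancels a denominator. -/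
theorem normBessel_mul_eq {s : ℝ} (hs : 1 / 2 < s) (z : ℝ) :
    normBessel (s + 1 / 2) z * normBessel (s + 1 / 2 + 1) z =
      powerSum (productCoeff s) (-(z ^ 2)) := by
  rw [normBessel, normBessel, hyp01_mul_hyp01 (by linarith) (by linarith), powerSum, powerSum]
  refine tsum_congr fun k => ?_
  have h1 := (rising_pos (show 0 < s + 1 / 2 by linarith) k).ne'
  have h2 := (rising_pos (show 0 < s + 1 / 2 + 1 by linarith) k).ne'
  have h3 := (rising_pos (show 0 < 2 * s + 1 by linarith) k).ne'
  have h4 := rising_two_mul (s + 1 / 2) k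
  rw [show 2 * (s + 1 / 2) = 2 * s + 1 by ring, two_mul k, rising_add,
    show s + 1 / 2 + 1 / 2 = s + 1 by ring] at h4
  have h5 : rising (2 * s + 1 + k) k =
      4 ^ k * (rising (s + 1 / 2) k * rising (s + 1) k) / rising (2 * s + 1) k := by
    rw [← h4]; field_simp
  rw [show s + 1 / 2 + (s + 1 / 2 + 1) + k - 1 = 2 * s + 1 + (k : ℝ) by ring, h5, productCoeff,
    show -(z ^ 2 / 4) = -(z ^ 2) / 4 by ring, div_pow]
  generalize rising (s + 1 / 2) k = A at *
  generalize rising (s + 1 / 2 + 1) k = B at *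
  field_simp

/-- The k-th Beta moment contributes the ratio of rising factorials of s + 1 and s + 3/2, raising
₀F₁ to ₁F₂. -/
theorem integral_betaDensity_mul_hyp01 {s : ℝ} (hs : 0 < s) (w : ℝ) :
    ∫ v in Set.Ioi (0 : ℝ), betaDensity (s + 1) (1 / 2) v * hyp01 (2 * s + 1) (-(v * w)) =
      Real.Gamma (s + 1) * Real.Gamma (1 / 2) / Real.Gamma (s + 1 / 2 + 1) *
        powerSum (productCoeff s) (-w) := by
  have hmom (k : ℕ) : Set.EqOn (betaDensity (s + 1 + k) (1 / 2))
      (fun v : ℝ => betaDensity (s + 1) (1 / 2) v * v ^ k) (Set.Ioi 0) := fun v hv => by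
    simp only
    rw [← rpow_mul_betaDensity _ _ _ hv, Real.rpow_natCast, mul_comm]
  have hB (k : ℕ) := betaDensity_integrable_and_integral (show 0 < s + 1 + k by positivity)
    (show (0 : ℝ) < 1 / 2 by norm_num)
  set B := Real.Gamma (s + 1) * Real.Gamma (1 / 2) / Real.Gamma (s + 1 / 2 + 1) with hBdef
  have hcm (k : ℕ) : 1 / (k.factorial * rising (2 * s + 1) k) *
      (B * (rising (s + 1) k / rising (s + 1 / 2 + 1) k)) = B * productCoeff s k := by
    rw [productCoeff]
    simp only [div_eq_mul_inv, mul_inv]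
    ring
  have h := integral_mul_powerSum (φ := betaDensity (s + 1) (1 / 2))
    (c := fun k => 1 / (k.factorial * rising (2 * s + 1) k))
    (m := fun k => B * (rising (s + 1) k / rising (s + 1 / 2 + 1) k))
    (w := -w) (fun v _ => betaDensity_nonneg _ _ v) (fun k => ?_) (fun k => ?_) ?_
  · simp only [hcm, mul_neg] at h
    rw [powerSum_const_mul] at h
    exact h
  · exact (hB k).1.congr_fun (hmom k) measurableSet_Ioi
  · rw [← setIntegral_congr_fun measurableSet_Ioi (hmom k), (hB k).2,
      Gamma_add_natCast (by linarith), show s + 1 + k + 1 / 2 = s + 1 / 2 + 1 + (k : ℝ) by ring,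
      Gamma_add_natCast (by linarith), hBdef]
    simp only [div_eq_mul_inv, mul_inv]
    ring
  · simp only [hcm]
    refine ((summable_norm_powerSum zero_le_one (norm_productCoeff_le hs) (-w)).mul_left |B|).congr
      fun k => ?_
    rw [Real.norm_eq_abs, ← abs_mul]
    congr 1
    ring

theorem integral_rpow_mul_productSum {s y : ℝ} (hs : 1 / 2 < s) (hy : 1 < y) (hys : y < 2 * s + 1) :
    ∫ w in Set.Ioi (0 : ℝ), w ^ ((2 * s + 1 - y) / 2 - 1) * powerSum (productCoeff s) (-w) =
      Real.Gamma ((y + 1) / 2) * Real.Gamma ((1 - y) / 2 + s) * Real.Gamma (2 * s + 1) *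
        Real.Gamma (s + 1 / 2 + 1) /
        (Real.Gamma (y / 2 + 1) * Real.Gamma ((1 + y) / 2 + s) * Real.Gamma (s + 1)) := by
  have hs0 : 0 < s := by linarith
  have hb : 1 ≤ 2 * s + 1 := by linarith
  set a := (2 * s + 1 - y) / 2 with ha
  have hint : IntegrableOn (fun w : ℝ => w ^ (a - 1) * hyp01 (2 * s + 1) (-w)) (Set.Ioi 0) := by
    -- Taking 2s + 1/2 for s gives parameter 2s + 1 and decay exponent s + 1/4, which exceeds a
    -- because y > 1 forces a < s.
    have hO := isBigO_hyp01_neg (show 1 / 2 < 2 * s + 1 / 2 by linarith)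
    rw [show 2 * s + 1 / 2 + 1 / 2 = 2 * s + 1 by ring] at hO
    exact integrableOn_rpow_mul_of_isBigO ((continuous_hyp01 hb).comp continuous_neg) hO
      (by linarith) (by linarith)
  have hφ : Set.EqOn (betaDensity ((y + 1) / 2) (1 / 2))
      (fun v => v ^ (-a) * betaDensity (s + 1) (1 / 2) v) (Set.Ioi 0) := fun v hv => by
    simp only
    rw [rpow_mul_betaDensity _ _ _ hv, show s + 1 + -a = (y + 1) / 2 by rw [ha]; ring]
  obtain ⟨hi, hI⟩ := betaDensity_integrable_and_integral (show 0 < (y + 1) / 2 by linarith)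
    (show (0 : ℝ) < 1 / 2 by norm_num)
  have hm1 := measurable_betaDensity (s + 1) (1 / 2)
  have hm2 := (continuous_hyp01 hb).measurable
  have h := integral_rpow_mul_average (φ := betaDensity (s + 1) (1 / 2))
    (h := fun w => hyp01 (2 * s + 1) (-w)) (a := a) hm1 (by fun_prop)
    (hi.congr_fun hφ measurableSet_Ioi) hint
  rw [← setIntegral_congr_fun measurableSet_Ioi hφ, hI,
    integral_rpow_mul_hyp01 hb (by linarith) (by linarith) hint] at h
  simp only [integral_betaDensity_mul_hyp01 hs0, mul_left_comm _ (_ / _)] at h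
  rw [integral_const_mul, show a = (1 - y) / 2 + s by rw [ha]; ring,
    show 2 * s + 1 - ((1 - y) / 2 + s) = (1 + y) / 2 + s by ring,
    show (y + 1) / 2 + 1 / 2 = y / 2 + 1 by ring] at h
  have g1 := Real.Gamma_pos_of_pos (show 0 < s + 1 by linarith)
  have g2 := Real.Gamma_pos_of_pos (show (0 : ℝ) < 1 / 2 by norm_num)
  have g3 := Real.Gamma_pos_of_pos (show 0 < s + 1 / 2 + 1 by linarith)
  have g4 := Real.Gamma_pos_of_pos (show 0 < y / 2 + 1 by linarith)
  have g5 := Real.Gamma_pos_of_pos (show 0 < (1 + y) / 2 + s by linarith)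
  rw [show a = (1 - y) / 2 + s by rw [ha]; ring]
  generalize ∫ w in Set.Ioi (0 : ℝ), w ^ ((1 - y) / 2 + s - 1) * powerSum (productCoeff s) (-w) = J
    at h ⊢
  field_simp at h ⊢
  linarith

theorem integral_rpow_mul_normBessel_mul {s y : ℝ} (hs : 1 / 2 < s) :
    ∫ z in Set.Ioi (0 : ℝ), z ^ (2 * s - y) *
      (normBessel (s + 1 / 2) z * normBessel (s + 1 / 2 + 1) z) =
    1 / 2 * ∫ w in Set.Ioi (0 : ℝ),
      w ^ ((2 * s + 1 - y) / 2 - 1) * powerSum (productCoeff s) (-w) := by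
  rw [← integral_comp_rpow_Ioi_of_pos (g := fun w : ℝ =>
    w ^ ((2 * s + 1 - y) / 2 - 1) * powerSum (productCoeff s) (-w)) two_pos, ← integral_const_mul]
  refine setIntegral_congr_fun measurableSet_Ioi fun z hz => ?_
  have hz : 0 < z := hz
  simp only [smul_eq_mul]
  rw [normBessel_mul_eq hs, ← Real.rpow_mul hz.le, Real.rpow_two]
  have e : z ^ (2 * s - y) = z ^ ((2 : ℝ) - 1) * z ^ (2 * ((2 * s + 1 - y) / 2 - 1)) := by
    rw [← Real.rpow_add hz]; congr 1; ring
  rw [e]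
  ring

theorem integrableOn_rpow_mul_besselKernel {s y : ℝ} (hs : 1 / 2 < s) (hy : 1 < y)
    (hys : y < 2 * s + 1) :
    IntegrableOn (fun z : ℝ => z ^ (2 * s - y) * besselKernel s z) (Set.Ioi 0) := by
  have := integrableOn_rpow_mul_of_isBigO (a := 2 * s + 1 - y) (continuous_besselKernel hs)
    (isBigO_besselKernel hs) (by linarith) (by linarith)
  rwa [show 2 * s + 1 - y - 1 = 2 * s - y by ring] at this

/-- Integrate the derivative of z^(2s+1-y)B. The boundary term at 0 vanishes because y < 2s + 1, the
one at infinity because B = O(z^(-2s)) and y > 1. -/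
theorem integral_rpow_mul_besselKernel {s y : ℝ} (hs : 1 / 2 < s) (hy : 1 < y)
    (hys : y < 2 * s + 1) :
    ∫ z in Set.Ioi (0 : ℝ), z ^ (2 * s - y) * besselKernel s z =
      2 * s / (y - 1) * ∫ z in Set.Ioi (0 : ℝ), z ^ (2 * s - y) *
        (normBessel (s + 1 / 2) z * normBessel (s + 1 / 2 + 1) z) := by
  have h1 := continuous_normBessel (show 1 ≤ s + 1 / 2 by linarith)
  have h2 := continuous_normBessel (show 1 ≤ s + 1 / 2 + 1 by linarith)
  have hi1 := integrableOn_rpow_mul_besselKernel hs hy hys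
  have hi2 : IntegrableOn (fun z : ℝ => z ^ (2 * s - y) *
      (normBessel (s + 1 / 2) z * normBessel (s + 1 / 2 + 1) z)) (Set.Ioi 0) := by
    have := integrableOn_rpow_mul_of_isBigO (a := 2 * s + 1 - y) (h1.mul h2)
      (isBigO_normBessel_mul hs) (by linarith) (by linarith)
    rw [show 2 * s + 1 - y - 1 = 2 * s - y by ring] at this
    exact this
  have hderiv (z : ℝ) (hz : z ∈ Set.Ioi (0 : ℝ)) :
      HasDerivAt (fun z => z ^ (2 * s + 1 - y) * besselKernel s z)
        ((1 - y) * (z ^ (2 * s - y) * besselKernel s z) + 2 * s * (z ^ (2 * s - y) *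
          (normBessel (s + 1 / 2) z * normBessel (s + 1 / 2 + 1) z))) z := by
    have hz : 0 < z := hz
    refine ((Real.hasDerivAt_rpow_const (p := 2 * s + 1 - y) (Or.inl hz.ne')).mul
      (hasDerivAt_besselKernel hs hz.ne')).congr_deriv ?_
    have e : z ^ (2 * s + 1 - y) = z ^ (2 * s - y) * z := by
      rw [← Real.rpow_add_one hz.ne']; congr 1; ring
    rw [show 2 * s + 1 - y - 1 = 2 * s - y by ring, e]
    field_simp
    ring
  have hcont : Continuous fun z : ℝ => z ^ (2 * s + 1 - y) * besselKernel s z :=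
    (Real.continuous_rpow_const (by linarith)).mul (continuous_besselKernel hs)
  have hlim : Tendsto (fun z : ℝ => z ^ (2 * s + 1 - y) * besselKernel s z) atTop (𝓝 0) := by
    have hO : (fun z : ℝ => z ^ (2 * s + 1 - y) * besselKernel s z) =O[atTop]
        fun z : ℝ => z ^ (-(y - 1)) := by
      refine ((Asymptotics.isBigO_refl (fun z : ℝ => z ^ (2 * s + 1 - y)) atTop).mul
        (isBigO_besselKernel hs)).congr' EventuallyEq.rfl ?_
      filter_upwards [eventually_gt_atTop 0] with z hz
      rw [← Real.rpow_add hz]; congr 1; ring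
    exact hO.trans_tendsto (tendsto_rpow_neg_atTop (by linarith))
  have h := integral_Ioi_of_hasDerivAt_of_tendsto hcont.continuousWithinAt hderiv
    ((hi1.const_mul (1 - y)).add (hi2.const_mul (2 * s))) hlim
  rw [Real.zero_rpow (by linarith), zero_mul, sub_zero,
    integral_add (hi1.const_mul (1 - y)) (hi2.const_mul (2 * s)), integral_const_mul,
    integral_const_mul] at h
  have : y - 1 ≠ 0 := by linarith
  rw [div_mul_eq_mul_div, eq_div_iff this]
  linarith

/-- The left side keeps the unsimplified shape of the change of variables z = x^(-1) in
`integral_comp_rpow_Ioi`. -/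
theorem rpow_mul_limitDensity_eqOn {s y : ℝ} (hs : 1 / 2 < s) :
    Set.EqOn (fun x : ℝ => (|(-1 : ℝ)| * x ^ ((-1 : ℝ) - 1)) •
      ((2 ^ (2 * s) / Real.pi * ((Real.Gamma (s + 1) * Real.Gamma (s + 1)) /
        (Real.Gamma (2 * s + 1) * Real.Gamma (2 * s + 2)))) *
        ((x ^ (-1 : ℝ)) ^ (2 * s - y) * besselKernel s (x ^ (-1 : ℝ)))))
      (fun x => x ^ y * limitDensity s x) (Set.Ioi 0) := fun x hx => by
  have hx : 0 < x := hx
  simp only [abs_neg, abs_one, one_mul, smul_eq_mul]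
  rw [limitDensity_eq hs hx, ← Real.rpow_mul hx.le, Real.rpow_neg_one x, ← one_div]
  have e : x ^ y * x ^ (-2 * s - 2) = x ^ ((-1 : ℝ) - 1) * x ^ (-1 * (2 * s - y)) := by
    rw [← Real.rpow_add hx, ← Real.rpow_add hx]; congr 1; ring
  linear_combination (-(2 ^ (2 * s) / Real.pi * ((Real.Gamma (s + 1) * Real.Gamma (s + 1)) /
    (Real.Gamma (2 * s + 1) * Real.Gamma (2 * s + 2))) * besselKernel s (1 / x))) * e

theorem integrableOn_rpow_mul_limitDensity {s y : ℝ} (hs : 1 / 2 < s) (hy : 1 < y)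
    (hys : y < 2 * s + 1) :
    IntegrableOn (fun x : ℝ => x ^ y * limitDensity s x) (Set.Ioi 0) := by
  refine IntegrableOn.congr_fun ?_ (rpow_mul_limitDensity_eqOn hs) measurableSet_Ioi
  exact (integrableOn_Ioi_comp_rpow_iff _ (by norm_num : (-1 : ℝ) ≠ 0)).2
    ((integrableOn_rpow_mul_besselKernel hs hy hys).const_mul _)

theorem integral_rpow_mul_limitDensity {s y : ℝ} (hs : 1 / 2 < s) (hy : 1 < y)
    (hys : y < 2 * s + 1) :
    ∫ x in Set.Ioi (0 : ℝ), x ^ y * limitDensity s x =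
        (s * Real.Gamma ((y - 1) / 2) * Real.Gamma ((1 - y) / 2 + s)) /
          (4 * √Real.pi * Real.Gamma (y / 2 + 1) * Real.Gamma ((1 + y) / 2 + s)) := by
  rw [← setIntegral_congr_fun measurableSet_Ioi (rpow_mul_limitDensity_eqOn hs)]
  rw [integral_comp_rpow_Ioi (fun z => 2 ^ (2 * s) / Real.pi *
    ((Real.Gamma (s + 1) * Real.Gamma (s + 1)) / (Real.Gamma (2 * s + 1) * Real.Gamma (2 * s + 2))) *
    (z ^ (2 * s - y) * besselKernel s z)) (by norm_num : (-1 : ℝ) ≠ 0), integral_const_mul,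
    integral_rpow_mul_besselKernel hs hy hys, integral_rpow_mul_normBessel_mul hs,
    integral_rpow_mul_productSum hs hy hys]
  -- Legendre duplication eliminates Γ(s+3/2) and the power 2^(2s) of the prefactor.
  have hdup := Real.Gamma_mul_Gamma_add_half (s + 1)
  rw [show s + 1 + 1 / 2 = s + 1 / 2 + 1 by ring, show 2 * (s + 1) = 2 * s + 2 by ring] at hdup
  -- The factor y - 1 cancels the denominator created by the integration by parts.
  have hy2 : Real.Gamma ((y + 1) / 2) = (y - 1) / 2 * Real.Gamma ((y - 1) / 2) := by
    rw [← Real.Gamma_add_one (by linarith : (y - 1) / 2 ≠ 0)]; congr 1; ring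
  have h2 : (2 : ℝ) ^ (1 - (2 * s + 2)) = 1 / (2 * 2 ^ (2 * s)) := by
    rw [show 1 - (2 * s + 2) = -(2 * s + 1) by ring, Real.rpow_neg zero_le_two,
      Real.rpow_add_one two_ne_zero]
    ring
  rw [h2] at hdup
  have g1 := Real.Gamma_pos_of_pos (show 0 < s + 1 by linarith)
  have g2 := Real.Gamma_pos_of_pos (show 0 < 2 * s + 1 by linarith)
  have g3 := Real.Gamma_pos_of_pos (show 0 < 2 * s + 2 by linarith)
  have g4 := Real.Gamma_pos_of_pos (show 0 < y / 2 + 1 by linarith)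
  have g5 := Real.Gamma_pos_of_pos (show 0 < (1 + y) / 2 + s by linarith)
  have hG : Real.Gamma (s + 1 / 2 + 1) =
      Real.Gamma (2 * s + 2) * (1 / (2 * 2 ^ (2 * s))) * √Real.pi / Real.Gamma (s + 1) := by
    rw [← hdup]; field_simp
  have hpi : Real.pi = √Real.pi * √Real.pi := (Real.mul_self_sqrt Real.pi_pos.le).symm
  have hpi0 : 0 < √Real.pi := Real.sqrt_pos.2 Real.pi_pos
  have hy1 : y - 1 ≠ 0 := by linarith
  have ht : (0 : ℝ) < 2 ^ (2 * s) := by positivity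
  rw [hy2, hG]
  nth_rewrite 1 [hpi]
  field_simp
  ring

end Moments

end

end CauchyEnsemble


theorem proposition6p4 (s : ℝ) (hs : 1 / 2 < s) :
    (∀ x : ℝ, 0 < x →
      Filter.Tendsto (fun N : ℕ => CauchyEnsemble.scaledDensity s N x) Filter.atTop
        (nhds (CauchyEnsemble.limitDensity s x : ℂ))) ∧
    ∀ y : ℝ, 1 < y → y < 2 * s + 1 →
      MeasureTheory.IntegrableOn (fun x : ℝ => x ^ y * CauchyEnsemble.limitDensity s x)
        (Set.Ioi 0) ∧
      ∫ x in Set.Ioi (0 : ℝ), x ^ y * CauchyEnsemble.limitDensity s x =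
        (s * Real.Gamma ((y - 1) / 2) * Real.Gamma ((1 - y) / 2 + s)) /
          (4 * Real.sqrt Real.pi * Real.Gamma (y / 2 + 1) * Real.Gamma ((1 + y) / 2 + s)) := by
  refine ⟨fun x hx => ?_, fun y hy hys =>
    ⟨CauchyEnsemble.integrableOn_rpow_mul_limitDensity hs hy hys,
      CauchyEnsemble.integral_rpow_mul_limitDensity hs hy hys⟩⟩
  rw [CauchyEnsemble.limitDensity_eq hs hx]
  exact CauchyEnsemble.tendsto_scaledDensity hs hx
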